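/- **Theorem (Thermodynamic limits for the annealed $\mathrm{CM}_N(\mathbf 1,\mathbf 2)$).** *Setting.* Fix $p\in(0,1)$. For each $N$ let $d_1,\dots,d_N\in\{1,2\}$ be degrees of which exactly $\lfloor pN\rfloor$ equal $2$ and $N-\lfloor pN\rfloor$ equal $1$. For those $N$ for which the total degree $N+\lfloor pN\rfloor$ is even, let $G_N$ be the configuration model with these degrees: attach $d_i$ half-edges to vertex $i$ and pair all half-edges uniformly at random (self-loops and multiple edges are allowed); $Q_N$ denotes expectation over $G_N$. All limits $N\to\infty$ are along these $N$. For $\sigma\in\{-1,1\}^N$ let $S_N=\sum_i\sigma_i$ and let $W_N(\sigma)=\exp\big[\beta\sum_{(i,j)\in E_N}\sigma_i\sigma_j+BS_N\big]$, the sum running over edges with multiplicity, and let $Z_N=\sum_\sigma W_N(\sigma)$. The annealed measure, pressure and magnetization are $$\widetilde P_N(\sigma)=\frac{Q_N(W_N(\sigma))}{Q_N(Z_N)},\qquad \widetilde\psi_N(\beta,B)=\frac1N\log Q_N(Z_N),\qquad \widetilde M_N(\beta,B)=\sum_\sigma\widetilde P_N(\sigma)\frac{S_N}{N}.$$ *Explicit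 functions.* For $\beta>0$, $B\in\mathbb R$ put $$\lambda_\pm=e^{\beta}\Big[\cosh B\pm\sqrt{\sinh^2B+e^{-4\beta}}\Big],\qquad A_\pm=\frac{e^{-2\beta}e^{\pm B}+(\lambda_+-e^{\beta+B})^2e^{\mp B}\pm2e^{-\beta}(\lambda_+-e^{\beta+B})}{[e^{-2\beta}+(\lambda_+-e^{\beta+B})^2]\,\lambda_\pm},$$ $r=\lambda_- /\lambda_+$, $a=A_- /A_+$, and on $D_p=[0,\frac{1-p}2]\times[0,p]$ let $$\begin{aligned}H(s,t)={}&(1-p)\log\tfrac{1-p}2-2s\log s-2\big(\tfrac{1-p}2-s\big)\log\big(\tfrac{1-p}2-s\big)+s\log(ar^2)+t\log r\\&+(s+t)\log(s+t)-t\log t+\big(\tfrac{1+p}2-s-t\big)\log\big(\tfrac{1+p}2-s-t\big)\\&-(p-t)\log(p-t)-\tfrac{1+p}2\log\tfrac{1+p}2+p\log p,\end{aligned}$$ with $0\log0=0$. One has $a>0$ if $B\ne0$ and $a=0$ if $B=0$; in the latter case $s\log(ar^2)$ is read as $-\infty$ for $s>0$ and as $0$ for $s=0$. *Statement.* For all $\beta>0$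 and $B\in\mathbb R$: (i) $H$ has a unique maximum point $(s^*,t^*)=(s^*,t^*)(\beta,B)$ on $D_p$. If $B\neq0$, then $H$ is strictly concave on $D_p$ and $(s^*,t^*)$ lies in the interior of $D_p$; if $B=0$, then $(s^*,t^*)=(0,0)$. The annealed pressure converges: $$\widetilde\psi(\beta,B):=\lim_{N\to\infty}\widetilde\psi_N(\beta,B)=\log\lambda_+(\beta,B)+\frac{1-p}2\log A_+(\beta,B)+H(s^*,t^*).$$ (ii) $\widetilde\psi(\beta,\cdot)$ is differentiable at $B$, and the annealed magnetization converges: $$\widetilde M(\beta,B):=\lim_{N\to\infty}\widetilde M_N(\beta,B)=\frac{\partial}{\partial B}\widetilde\psi(\beta,B),$$ and it equals $$\frac{\partial}{\partial B}\log\lambda_++\frac{1-p}2\frac{\partial}{\partial B}\log A_++s^*\frac{\partial}{\partial B}\log(ar^2)+t^*\frac{\partial}{\partial B}\log r,$$ where all the derivatives exist, except that for $B=0$ the third term is read as $0$ (there $s^*=0$). (iii) $\lim_{B\to0^+}\widetilde M(\beta,B)=0$ for every $\beta>0$. Consequently $\beta_c:=\inf\{\beta>0:\lim_{B\to0^+}\widetilde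 M(\beta,B)>0\}=\inf\emptyset=\infty$, that is, there is no annealed phase transition. -/

import Mathlib

open Filter Topology

namespace AnnealedIsing

noncomputable section

/-! ## The configuration model -/

/-- The half-edges of a degree sequence `d`: vertex `i` carries `d i` of them. -/
abbrev HalfEdge {N : ℕ} (d : Fin N → ℕ) : Type := Σ i : Fin N, Fin (d i)

/-- The pairings of the half-edges (fixed-point-free involutions). A pairing is a realisation of the
configuration model: every pair `{h, π h}` is an edge between the vertices `h.1` and `(π h).1`,
self-loops and multiple edges being allowed. -/
abbrev Pairing {N : ℕ} (d : Fin N → ℕ) : Type :=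
  {π : Equiv.Perm (HalfEdge d) // ∀ h, π (π h) = h ∧ π h ≠ h}

/-- Expectation with respect to the configuration model with degrees `d`, that is, with respect to a
uniformly random pairing of the half-edges. -/
def cmExpect {N : ℕ} (d : Fin N → ℕ) (X : Pairing d → ℝ) : ℝ :=
  (∑ π : Pairing d, X π) / (Fintype.card (Pairing d) : ℝ)

/-- `d` is a degree sequence of `CM_N(1,2)` with parameter `p`: all degrees are `1` or `2`, and exactly
`⌊pN⌋` vertices have degree `2` (so `N - ⌊pN⌋` have degree `1`). -/
def IsOneTwoDegrees (p : ℝ) {N : ℕ} (d : Fin N → ℕ) : Prop :=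
  (∀ i, d i = 1 ∨ d i = 2) ∧ (Finset.univ.filter fun i => d i = 2).card = ⌊p * (N : ℝ)⌋₊

/-- `N → ∞` along those sizes for which the total degree is even, i.e. for which the configuration
model with degrees `d N` exists. -/
def evenSizes (d : (N : ℕ) → Fin N → ℕ) : Filter ℕ :=
  atTop ⊓ 𝓟 {N | Even (∑ i, d N i)}

/-! ## The annealed Ising model -/

/-- The real value `±1` of the spin at vertex `i`; spin configurations are maps to `ℤˣ = {1, -1}`. -/
def spin {N : ℕ} (σ : Fin N → ℤˣ) (i : Fin N) : ℝ := ((σ i : ℤ) : ℝ)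

/-- The total spin `S_N`. -/
def totalSpin {N : ℕ} (σ : Fin N → ℤˣ) : ℝ := ∑ i, spin σ i

/-- The sum of `σ_i σ_j` over all edges `(i,j)` of the multigraph, with multiplicity. Every edge has two
half-edges (also when it is a self-loop), which explains the factor `1 / 2`. -/
def edgeSum {N : ℕ} {d : Fin N → ℕ} (π : Pairing d) (σ : Fin N → ℤˣ) : ℝ :=
  (1 / 2) * ∑ h : HalfEdge d, spin σ h.1 * spin σ (π.1 h).1

/-- The Boltzmann weight of `σ` on a given multigraph. -/
def boltzmannWeight {N : ℕ} {d : Fin N → ℕ} (β B : ℝ) (π : Pairing d) (σ : Fin N → ℤˣ) : ℝ :=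
  Real.exp (β * edgeSum π σ + B * totalSpin σ)

/-- The partition function `Z_N(β, B)` of a given multigraph. -/
def partitionFunction {N : ℕ} {d : Fin N → ℕ} (β B : ℝ) (π : Pairing d) : ℝ :=
  ∑ σ : Fin N → ℤˣ, boltzmannWeight β B π σ

/-- The annealed measure: numerator and denominator of the Gibbs measure are averaged separately. -/
def annealedMeasure {N : ℕ} (d : Fin N → ℕ) (β B : ℝ) (σ : Fin N → ℤˣ) : ℝ :=
  cmExpect d (fun π => boltzmannWeight β B π σ) / cmExpect d (partitionFunction β B)

/-- The annealed pressure `(1/N) log Q_N(Z_N(β, B))`. -/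
def annealedPressure {N : ℕ} (d : Fin N → ℕ) (β B : ℝ) : ℝ :=
  (1 / (N : ℝ)) * Real.log (cmExpect d (partitionFunction β B))

/-- The annealed magnetization, the mean of `S_N / N` under the annealed measure. -/
def annealedMagnetization {N : ℕ} (d : Fin N → ℕ) (β B : ℝ) : ℝ :=
  ∑ σ : Fin N → ℤˣ, annealedMeasure d β B σ * (totalSpin σ / (N : ℝ))

/-- The critical inverse temperature `inf {β > 0 : M(β, 0⁺) > 0}` of a limiting magnetization `M`, where
`M(β, 0⁺) = lim_{B → 0⁺} M(β, B)`; it is `⊤` when the set is empty. -/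
def criticalInverseTemperature (M : ℝ → ℝ → ℝ) : EReal :=
  sInf ((fun β : ℝ => (β : EReal)) ''
    {β : ℝ | 0 < β ∧ ∃ m : ℝ, 0 < m ∧ Tendsto (M β) (𝓝[>] 0) (𝓝 m)})

/-! ## The explicit functions -/

/-- `λ₊(β, B)` -/
def lamPlus (β B : ℝ) : ℝ :=
  Real.exp β * (Real.cosh B + Real.sqrt (Real.sinh B ^ 2 + Real.exp (-4 * β)))

/-- `λ₋(β, B)` -/
def lamMinus (β B : ℝ) : ℝ :=
  Real.exp β * (Real.cosh B - Real.sqrt (Real.sinh B ^ 2 + Real.exp (-4 * β)))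

/-- `A₊(β, B)` -/
def APlus (β B : ℝ) : ℝ :=
  (Real.exp (-2 * β) * Real.exp B + (lamPlus β B - Real.exp (β + B)) ^ 2 * Real.exp (-B)
      + 2 * Real.exp (-β) * (lamPlus β B - Real.exp (β + B)))
    / ((Real.exp (-2 * β) + (lamPlus β B - Real.exp (β + B)) ^ 2) * lamPlus β B)

/-- `A₋(β, B)` -/
def AMinus (β B : ℝ) : ℝ :=
  (Real.exp (-2 * β) * Real.exp (-B) + (lamPlus β B - Real.exp (β + B)) ^ 2 * Real.exp B
      - 2 * Real.exp (-β) * (lamPlus β B - Real.exp (β + B)))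
    / ((Real.exp (-2 * β) + (lamPlus β B - Real.exp (β + B)) ^ 2) * lamMinus β B)

/-- `a(β, B) = A₋ / A₊`. It is positive for `B ≠ 0`, and zero for `B = 0`. -/
def aRatio (β B : ℝ) : ℝ := AMinus β B / APlus β B

/-- `r(β, B) = λ₋ / λ₊` -/
def rRatio (β B : ℝ) : ℝ := lamMinus β B / lamPlus β B

/-- The rectangle `D_p = [0, (1-p)/2] × [0, p]`. -/
def rect (p : ℝ) : Set (ℝ × ℝ) := Set.Icc 0 ((1 - p) / 2) ×ˢ Set.Icc 0 p

/-- The function `H(s, t)`, `z = (s, t)`, by its formula. On the boundary of the rectangle `0 log 0 = 0`,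
which is the continuous extension. -/
def H (p β B : ℝ) (z : ℝ × ℝ) : ℝ :=
  (1 - p) * Real.log ((1 - p) / 2) - 2 * z.1 * Real.log z.1
    - 2 * ((1 - p) / 2 - z.1) * Real.log ((1 - p) / 2 - z.1)
    + z.1 * Real.log (aRatio β B * rRatio β B ^ 2) + z.2 * Real.log (rRatio β B)
    + (z.1 + z.2) * Real.log (z.1 + z.2) - z.2 * Real.log z.2
    + ((1 + p) / 2 - z.1 - z.2) * Real.log ((1 + p) / 2 - z.1 - z.2)
    - (p - z.2) * Real.log (p - z.2)
    - (1 + p) / 2 * Real.log ((1 + p) / 2) + p * Real.log p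

/-- `H` with its value `-∞` where the term `s log (a r²)` is `-∞`, that is, for `a = 0` and `s > 0`.
As `a > 0` for `B ≠ 0`, this differs from `H` only at `B = 0`. -/
def HExt (p β B : ℝ) (z : ℝ × ℝ) : EReal :=
  open Classical in if aRatio β B = 0 ∧ 0 < z.1 then ⊥ else (H p β B z : EReal)

end

end AnnealedIsing

/-!
The expectation over the uniform pairing is computed with Wick's formula. Diagonalising the
transfer matrix writes the weight of an edge as `f₊(σ) f₊(τ) + f₋(σ) f₋(τ)`, so that the sum over
all pairings is the moment of a product of linear forms of a planar Gaussian vector, or, by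
homogeneity, of a uniform point `(x, y)` of the unit circle. The spins now decouple, and
`Q_N(Z_N)` becomes, up to a factor polynomial in `N`, the circle average of
`(√A₊ λ₊ x + √A₋ λ₋ y) ^ n₁ * (λ₊ x² + λ₋ y²) ^ n₂`, where `n₁` and `n₂` count the vertices of
degree one and two. By Laplace's method its growth rate is the maximum of the logarithm of the
integrand over the circle. Gibbs' inequality, applied to the terms `x`, `v y` and `x²`, `r y²` of
the integrand, or to `x² + y² = 1`, shows that this maximum equals the maximum of `H` over the
rectangle; it also gives the strict concavity of `H` and the location of its maximum point.

The pressures are convex in `B`, so their derivatives converge to the derivative of the limit,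
which the envelope theorem computes. A differentiable, convex and even function has a continuous
derivative vanishing at `0`, hence there is no phase transition.
-/

namespace AnnealedIsing

open Real (circleAverage)

/-! ### Perfect matchings -/

/-- Perfect matchings of `E`, encoded like `Pairing` as fixed-point-free involutions. -/
abbrev Matching (E : Type*) : Type _ := {π : Equiv.Perm E // ∀ h, π (π h) = h ∧ π h ≠ h}

/-- The number of perfect matchings of a set with `n` elements: `(n - 1)‼` for even `n`, and `0` for
odd `n`. -/
def matchingNumber : ℕ → ℕ
  | 0 => 1
  | 1 => 0
  | n + 2 => (n + 1) * matchingNumber n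

lemma matchingNumber_add_two (n : ℕ) : matchingNumber (n + 2) = (n + 1) * matchingNumber n := rfl

lemma matchingNumber_two_mul_mul (m : ℕ) :
    matchingNumber (2 * m) * (2 ^ m * m.factorial) = (2 * m).factorial := by
  induction m with
  | zero => rfl
  | succ m ih =>
    rw [Nat.mul_succ, matchingNumber, Nat.factorial_succ (2 * m + 1), Nat.factorial_succ (2 * m),
      ← ih, Nat.factorial_succ m]
    ring

lemma matchingNumber_eq_zero_of_odd {n : ℕ} (hn : Odd n) : matchingNumber n = 0 := by
  obtain ⟨m, rfl⟩ := hn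
  induction m with
  | zero => rfl
  | succ m ih => rw [show 2 * (m + 1) + 1 = 2 * m + 1 + 2 by ring, matchingNumber, ih, mul_zero]

lemma matchingNumber_pos {n : ℕ} (hn : Even n) : 0 < matchingNumber n := by
  obtain ⟨m, rfl⟩ := hn
  induction m with
  | zero => simp [matchingNumber]
  | succ m ih =>
    rw [show m + 1 + (m + 1) = m + m + 2 by ring, matchingNumber_add_two]
    positivity

lemma matchingNumber_le_doubleFactorial (n : ℕ) : matchingNumber n ≤ n.doubleFactorial := by
  induction n using Nat.twoStepInduction with
  | zero => simp [matchingNumber]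
  | one => simp [matchingNumber]
  | more n ih _ =>
    rw [matchingNumber_add_two, Nat.doubleFactorial_add_two]
    gcongr
    lia

lemma doubleFactorial_le_mul_matchingNumber {n : ℕ} (hn : Even n) :
    n.doubleFactorial ≤ (n + 1) * matchingNumber n := by
  obtain ⟨m, rfl⟩ := hn
  induction m with
  | zero => simp [matchingNumber]
  | succ m ih =>
    rw [show m + 1 + (m + 1) = m + m + 2 by ring, matchingNumber_add_two,
      Nat.doubleFactorial_add_two]
    calc (m + m + 2) * (m + m).doubleFactorial
        ≤ (m + m + 3) * ((m + m + 1) * matchingNumber (m + m)) := by gcongr; lia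
      _ = (m + m + 2 + 1) * ((m + m + 1) * matchingNumber (m + m)) := by ring

section Matching

variable {E : Type*} [Fintype E] [DecidableEq E]

lemma Matching.cycleType_eq_replicate (π : Matching E) :
    π.1.cycleType = Multiset.replicate (Multiset.card π.1.cycleType) 2 := by
  refine Multiset.eq_replicate_card.2 fun n hn => ?_
  have hsq : π.1 ^ 2 = 1 := Equiv.ext fun h => by simp [pow_two, (π.2 h).1]
  have hle : n ≤ 2 := Nat.le_of_dvd two_pos
    ((Equiv.Perm.dvd_of_mem_cycleType hn).trans (orderOf_dvd_of_pow_eq_one hsq))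
  exact hle.antisymm (Equiv.Perm.two_le_of_mem_cycleType hn)

lemma Matching.card_cycleType_mul_two (π : Matching E) :
    Multiset.card π.1.cycleType * 2 = Fintype.card E := by
  have hsupport : π.1.support = Finset.univ := by
    ext h
    simp [(π.2 h).2]
  have hsum := π.1.sum_cycleType
  rwa [π.cycleType_eq_replicate, Multiset.sum_replicate, hsupport, Finset.card_univ] at hsum

lemma fixedPointFree_involutive_iff_cycleType {m : ℕ} (hE : Fintype.card E = 2 * m)
    (g : Equiv.Perm E) :
    (∀ h, g (g h) = h ∧ g h ≠ h) ↔ g.cycleType = Multiset.replicate m 2 := by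
  constructor
  · intro hg
    have hcard := Matching.card_cycleType_mul_two ⟨g, hg⟩
    rw [Matching.cycleType_eq_replicate ⟨g, hg⟩]
    congr 1
    simp only at hcard ⊢
    omega
  · intro hg h
    have hsupport : g.support = Finset.univ := by
      rw [← Finset.card_eq_iff_eq_univ, ← g.sum_cycleType, hg, hE, Multiset.sum_replicate,
        smul_eq_mul, mul_comm]
    have horder : orderOf g ∣ 2 := by
      rw [← g.lcm_cycleType, hg, Multiset.lcm_dvd]
      exact fun b hb => (Multiset.eq_of_mem_replicate hb).dvd
    refine ⟨?_, Equiv.Perm.mem_support.1 (hsupport ▸ Finset.mem_univ h)⟩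
    rw [← Equiv.Perm.mul_apply, ← pow_two, orderOf_dvd_iff_pow_eq_one.1 horder,
      Equiv.Perm.one_apply]

theorem card_matching : Fintype.card (Matching E) = matchingNumber (Fintype.card E) := by
  rcases Nat.even_or_odd' (Fintype.card E) with ⟨m, hE | hE⟩
  · have hcount := Equiv.Perm.card_of_cycleType_mul_eq E (Multiset.replicate m 2)
    rw [if_pos ⟨by simp [hE, mul_comm], fun a ha => (Multiset.eq_of_mem_replicate ha).ge⟩] at hcount
    have hmult : ∏ n ∈ (Multiset.replicate m 2).toFinset,
        ((Multiset.replicate m 2).count n).factorial = m.factorial := by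
      rcases Nat.eq_zero_or_pos m with rfl | hm
      · simp
      · simp [Multiset.toFinset_replicate, hm.ne']
    simp only [hE, Multiset.sum_replicate, Multiset.prod_replicate, hmult, smul_eq_mul,
      mul_comm m 2, Nat.sub_self, Nat.factorial_zero, one_mul] at hcount
    have hfilter : Fintype.card (Matching E) = (Finset.univ.filter fun g : Equiv.Perm E =>
        g.cycleType = Multiset.replicate m 2).card :=
      Fintype.card_of_subtype _ fun g => by
        rw [Finset.mem_filter_univ, fixedPointFree_involutive_iff_cycleType hE g]
    rw [hfilter, hE]
    refine Nat.eq_of_mul_eq_mul_right (by positivity : 0 < 2 ^ m * m.factorial) ?_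
    rw [matchingNumber_two_mul_mul, hcount]
  · have : IsEmpty (Matching E) := ⟨fun π => by
      have := π.card_cycleType_mul_two
      omega⟩
    rw [Fintype.card_eq_zero, matchingNumber_eq_zero_of_odd ⟨m, hE⟩]

/-- A matching that preserves a colouring amounts to a matching of each colour class. -/
def colourPreservingMatchingEquiv {E : Type*} (c : E → Bool) :
    {π : Matching E // ∀ h, c (π.1 h) = c h} ≃ ((b : Bool) → Matching {h : E // c h = b}) where
  toFun π b :=
    ⟨π.1.1.subtypePerm (fun h => by rw [π.2 h]), fun h => by
      refine ⟨Subtype.ext ?_, fun e => (π.1.2 h).2 (congrArg Subtype.val e)⟩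
      simp [(π.1.2 h).1]⟩
  invFun f := by
    have hc : ∀ h, c ((f (c h)).1 ⟨h, rfl⟩).1 = c h := fun h => ((f (c h)).1 ⟨h, rfl⟩).2
    have hcast : ∀ h (b : Bool) (hb : c h = b),
        (f (c h)).1 ⟨h, rfl⟩ = ((f b).1 ⟨h, hb⟩).1 := by
      rintro h b rfl
      rfl
    have hinv : ∀ h,
        ((f (c ((f (c h)).1 ⟨h, rfl⟩).1)).1 ⟨((f (c h)).1 ⟨h, rfl⟩).1, rfl⟩).1 = h := by
      intro h
      rw [hcast _ (c h) (hc h)]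
      simp [((f (c h)).2 ⟨h, rfl⟩).1]
    exact ⟨⟨⟨fun h => ((f (c h)).1 ⟨h, rfl⟩).1, fun h => ((f (c h)).1 ⟨h, rfl⟩).1, hinv, hinv⟩,
      fun h => ⟨hinv h, fun e => ((f (c h)).2 ⟨h, rfl⟩).2 (Subtype.ext e)⟩⟩, hc⟩
  left_inv π := by
    ext h
    rfl
  right_inv f := by
    ext b ⟨h, hb⟩
    subst hb
    rfl

lemma card_colourPreserving_matching (c : E → Bool) :
    (Finset.univ.filter fun π : Matching E => ∀ h, c (π.1 h) = c h).card
      = matchingNumber (Finset.univ.filter fun h => c h = true).card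
        * matchingNumber (Finset.univ.filter fun h => c h = false).card := by
  rw [← Fintype.card_subtype, Fintype.card_congr (colourPreservingMatchingEquiv c),
    Fintype.card_pi, Fintype.prod_bool, card_matching, card_matching, Fintype.card_subtype,
    Fintype.card_subtype]

/-! ### Wick's formula on the circle -/

lemma exists_representatives {E : Type*} [Fintype E] (π : Matching E) :
    ∃ R : Finset E, (∀ h, h ∈ R ↔ π.1 h ∉ R) ∧
      ∀ G : E → ℝ, ∏ h, G h = ∏ h ∈ R, G h * G (π.1 h) := by
  classical
  let e := Fintype.equivFin E
  let R := Finset.univ.filter fun h => e h < e (π.1 h)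
  have hR : ∀ h, h ∈ R ↔ π.1 h ∉ R := fun h => by
    have hne : e h ≠ e (π.1 h) := fun he => (π.2 h).2 (e.injective he).symm
    simp only [R, Finset.mem_filter_univ, (π.2 h).1, not_lt]
    exact ⟨le_of_lt, fun hle => hle.lt_of_ne hne⟩
  have hRc : ∀ h, h ∈ Rᶜ ↔ π.1 h ∈ R := fun h => by
    rw [Finset.mem_compl, hR (π.1 h), (π.2 h).1]
  refine ⟨R, hR, fun G => ?_⟩
  rw [← Finset.prod_mul_prod_compl R, Finset.prod_mul_distrib]
  congr 1
  refine Finset.prod_bij' (fun h _ => π.1 h) (fun h _ => π.1 h) (fun h hh => (hRc h).1 hh)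
    (fun h hh => ?_) (fun h _ => (π.2 h).1) (fun h _ => (π.2 h).1) fun h _ => ?_
  · rw [hRc, (π.2 h).1]
    exact hh
  · rw [(π.2 h).1]

lemma sum_preserved_colouring_eq_prod_sqrt (π : Matching E) (F : Bool → E → ℝ)
    (hF : ∀ h h', 0 ≤ ∑ b, F b h * F b h') :
    ∑ c : E → Bool with ∀ h, c (π.1 h) = c h, ∏ h, F (c h) h
      = ∏ h, √(∑ b, F b h * F b (π.1 h)) := by
  obtain ⟨R, hR, hprod⟩ := exists_representatives π
  have hRnot : ∀ h, h ∉ R → π.1 h ∈ R := fun h hh => not_not.1 (mt (hR h).2 hh)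
  have hsqrt : ∀ h, √(∑ b, F b h * F b (π.1 h)) * √(∑ b, F b (π.1 h) * F b (π.1 (π.1 h)))
      = ∑ b, F b h * F b (π.1 h) := fun h => by
    simp only [(π.2 h).1, mul_comm (F _ (π.1 h)), Real.mul_self_sqrt (hF h (π.1 h))]
  rw [hprod, ← Finset.prod_coe_sort]
  simp only [hsqrt]
  rw [Fintype.prod_sum]
  refine Finset.sum_bij' (fun c _ (h : R) => c h)
    (fun c _ h => if hh : h ∈ R then c ⟨h, hh⟩ else c ⟨π.1 h, hRnot h hh⟩)
    (fun _ _ => Finset.mem_univ _) (fun c _ => ?_) (fun c hc => ?_) (fun c _ => ?_) fun c hc => ?_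
  · rw [Finset.mem_filter_univ]
    intro h
    by_cases hh : h ∈ R
    · simp [hh, (hR h).1 hh, (π.2 h).1]
    · simp [hh, hRnot h hh]
  · rw [Finset.mem_filter_univ] at hc
    ext h
    simp [hc]
  · ext h
    simp
  · rw [Finset.mem_filter_univ] at hc
    rw [hprod, ← Finset.prod_coe_sort]
    simp [hc]

end Matching

lemma re_sq_add_im_sq_of_mem_sphere {z : ℂ} (hz : z ∈ Metric.sphere (0 : ℂ) 1) :
    z.re ^ 2 + z.im ^ 2 = 1 := by
  rw [pow_two, pow_two, ← Complex.normSq_apply, Complex.normSq_eq_norm_sq,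
    mem_sphere_zero_iff_norm.1 hz, one_pow]

lemma circleAverage_re_pow_mul_im_pow_add (a b : ℕ) :
    circleAverage (fun z => z.re ^ (a + 2) * z.im ^ b) 0 1
      + circleAverage (fun z => z.re ^ a * z.im ^ (b + 2)) 0 1
      = circleAverage (fun z => z.re ^ a * z.im ^ b) 0 1 := by
  have hint : ∀ a b : ℕ, CircleIntegrable (fun z => z.re ^ a * z.im ^ b) 0 1 := fun a b =>
    ContinuousOn.circleIntegrable' (by fun_prop)
  rw [← Real.circleAverage_fun_add (hint _ _) (hint _ _)]
  refine Real.circleAverage_congr_sphere fun z hz => ?_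
  linear_combination z.re ^ a * z.im ^ b * re_sq_add_im_sq_of_mem_sphere (by simpa using hz)

lemma circleAverage_re_pow_mul_im_pow_by_parts (a b : ℕ) :
    (a + 1) * circleAverage (fun z => z.re ^ a * z.im ^ (b + 2)) 0 1
      = (b + 1) * circleAverage (fun z => z.re ^ (a + 2) * z.im ^ b) 0 1 := by
  have hderiv : ∀ θ : ℝ, HasDerivAt (fun θ => Real.cos θ ^ (a + 1) * Real.sin θ ^ (b + 1))
      ((b + 1) * (Real.cos θ ^ (a + 2) * Real.sin θ ^ b)
        - (a + 1) * (Real.cos θ ^ a * Real.sin θ ^ (b + 2))) θ := fun θ => by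
    refine (((Real.hasDerivAt_cos θ).fun_pow (a + 1)).fun_mul
      ((Real.hasDerivAt_sin θ).fun_pow (b + 1))).congr_deriv ?_
    simp only [Nat.cast_add, Nat.cast_one, Nat.add_sub_cancel]
    ring
  have hint := intervalIntegral.integral_eq_sub_of_hasDerivAt (a := 0) (b := 2 * Real.pi)
    (fun θ _ => hderiv θ) (Continuous.intervalIntegrable (by fun_prop) _ _)
  rw [intervalIntegral.integral_sub (Continuous.intervalIntegrable (by fun_prop) _ _)
      (Continuous.intervalIntegrable (by fun_prop) _ _), intervalIntegral.integral_const_mul,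
    intervalIntegral.integral_const_mul] at hint
  simp only [Real.sin_zero, Real.sin_two_pi, pow_succ _ b, mul_zero, sub_zero] at hint
  simp only [Real.circleAverage_def, smul_eq_mul, circleMap_zero, Complex.ofReal_one, one_mul,
    Complex.exp_ofReal_mul_I_re, Complex.exp_ofReal_mul_I_im]
  linear_combination -(2 * Real.pi)⁻¹ * hint

lemma circleAverage_re_pow_add_two_mul_im_pow (a b : ℕ) :
    (a + b + 2) * circleAverage (fun z => z.re ^ (a + 2) * z.im ^ b) 0 1
      = (a + 1) * circleAverage (fun z => z.re ^ a * z.im ^ b) 0 1 := by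
  linear_combination (a + 1) * circleAverage_re_pow_mul_im_pow_add a b
    - circleAverage_re_pow_mul_im_pow_by_parts a b

lemma circleAverage_re_pow_mul_im_pow_add_two (a b : ℕ) :
    (a + b + 2) * circleAverage (fun z => z.re ^ a * z.im ^ (b + 2)) 0 1
      = (b + 1) * circleAverage (fun z => z.re ^ a * z.im ^ b) 0 1 := by
  linear_combination (b + 1) * circleAverage_re_pow_mul_im_pow_add a b
    + circleAverage_re_pow_mul_im_pow_by_parts a b

theorem doubleFactorial_mul_circleAverage (a b : ℕ) :
    ((a + b).doubleFactorial : ℝ) * circleAverage (fun z => z.re ^ a * z.im ^ b) 0 1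
      = matchingNumber a * matchingNumber b := by
  have him : ∀ a b : ℕ, ((a + b).doubleFactorial : ℝ)
        * circleAverage (fun z => z.re ^ a * z.im ^ b) 0 1 = matchingNumber a * matchingNumber b →
      ((a + (b + 2)).doubleFactorial : ℝ) * circleAverage (fun z => z.re ^ a * z.im ^ (b + 2)) 0 1
        = matchingNumber a * matchingNumber (b + 2) := fun a b ih => by
    rw [← add_assoc, Nat.doubleFactorial_add_two, matchingNumber_add_two]
    push_cast
    linear_combination ((a + b).doubleFactorial : ℝ) * circleAverage_re_pow_mul_im_pow_add_two a b
      + (b + 1) * ih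
  induction a using Nat.twoStepInduction with
  | zero =>
    induction b using Nat.twoStepInduction with
    | zero => simp [matchingNumber, Real.circleAverage_const]
    | one => simp [matchingNumber, Real.circleAverage_def, circleMap_zero]
    | more b ih _ => exact him 0 b ih
  | one =>
    induction b using Nat.twoStepInduction with
    | zero => simp [matchingNumber, Real.circleAverage_def, circleMap_zero]
    | one => simp [matchingNumber, Real.circleAverage_def, circleMap_zero, mul_comm (Real.cos _)]
    | more b ih _ => exact him 1 b ih
  | more a ih _ =>
    rw [add_right_comm, Nat.doubleFactorial_add_two, matchingNumber_add_two]
    push_cast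
    linear_combination ((a + b).doubleFactorial : ℝ) * circleAverage_re_pow_add_two_mul_im_pow a b
      + (a + 1) * ih

/-- Wick's formula for two-component vectors `(F true h, F false h)`. The uniform measure on the
unit circle replaces the planar Gaussian, at the price of the factor `(card E)‼`. -/
theorem sum_matching_prod_sqrt {E : Type*} [Fintype E] [DecidableEq E] (F : Bool → E → ℝ)
    (hF : ∀ h h', 0 ≤ ∑ b, F b h * F b h') :
    ∑ π : Matching E, ∏ h, √(∑ b, F b h * F b (π.1 h))
      = (Fintype.card E).doubleFactorial
        * circleAverage (fun z => ∏ h, (F true h * z.re + F false h * z.im)) 0 1 := by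
  let A : (E → Bool) → ℕ := fun c => (Finset.univ.filter fun h => c h = true).card
  let D : (E → Bool) → ℕ := fun c => (Finset.univ.filter fun h => c h = false).card
  have hcard : ∀ c, A c + D c = Fintype.card E := fun c => by
    simpa [A, D] using Finset.card_filter_add_card_filter_not (s := Finset.univ) (c · = true)
  have hexpand : ∀ z : ℂ, ∏ h, (F true h * z.re + F false h * z.im)
      = ∑ c : E → Bool, (∏ h, F (c h) h) • (z.re ^ A c * z.im ^ D c) := fun z => by
    have := Finset.prod_univ_sum (fun _ : E => (Finset.univ : Finset Bool))
      fun h b => F b h * cond b z.re z.im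
    simp only [Fintype.sum_bool, cond_true, cond_false, Fintype.piFinset_univ] at this
    rw [this]
    refine Finset.sum_congr rfl fun c _ => ?_
    simp only [Finset.prod_mul_distrib, Bool.cond_eq_ite, Finset.prod_ite, Finset.prod_const,
      Bool.not_eq_true, smul_eq_mul, A, D]
  calc ∑ π : Matching E, ∏ h, √(∑ b, F b h * F b (π.1 h))
      = ∑ c : E → Bool, ∑ π : Matching E with ∀ h, c (π.1 h) = c h, ∏ h, F (c h) h := by
        simp only [← sum_preserved_colouring_eq_prod_sqrt _ F hF, Finset.sum_filter]
        exact Finset.sum_comm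
    _ = ∑ c : E → Bool, (matchingNumber (A c) * matchingNumber (D c) : ℝ) * ∏ h, F (c h) h := by
        simp only [Finset.sum_const, card_colourPreserving_matching, nsmul_eq_mul, Nat.cast_mul,
          A, D]
    _ = _ := by
        simp only [hexpand]
        rw [Real.circleAverage_fun_sum fun c _ => ContinuousOn.circleIntegrable' (by fun_prop),
          Finset.mul_sum]
        refine Finset.sum_congr rfl fun c _ => ?_
        rw [Real.circleAverage_fun_smul, smul_eq_mul, ← doubleFactorial_mul_circleAverage, hcard]
        ring

/-! ### The transfer matrix -/

section TransferMatrix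

variable {β : ℝ}

lemma lamPlus_add_lamMinus (β B : ℝ) :
    lamPlus β B + lamMinus β B = Real.exp (β + B) + Real.exp (β - B) := by
  rw [lamPlus, lamMinus, Real.exp_add, sub_eq_add_neg β, Real.exp_add, Real.cosh_eq]
  ring

lemma lamPlus_mul_lamMinus (β B : ℝ) :
    lamPlus β B * lamMinus β B = Real.exp (2 * β) - Real.exp (-2 * β) := by
  have hsqrt := Real.sq_sqrt (show 0 ≤ Real.sinh B ^ 2 + Real.exp (-4 * β) by positivity)
  have hexp : Real.exp (2 * β) = Real.exp β ^ 2 := by rw [← Real.exp_nat_mul]; norm_num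
  have hexp' : Real.exp (-2 * β) = Real.exp β ^ 2 * Real.exp (-4 * β) := by
    rw [← hexp, ← Real.exp_add]; ring_nf
  rw [lamPlus, lamMinus, hexp', hexp]
  linear_combination (-Real.exp β ^ 2) * hsqrt + Real.exp β ^ 2 * Real.cosh_sq B

lemma lamPlus_pos (β B : ℝ) : 0 < lamPlus β B := by
  have := Real.cosh_pos B
  rw [lamPlus]
  positivity

lemma lamMinus_pos (hβ : 0 < β) (B : ℝ) : 0 < lamMinus β B := by
  have hlt : Real.exp (-2 * β) < Real.exp (2 * β) := Real.exp_lt_exp.2 (by linarith)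
  exact pos_of_mul_pos_right (by rw [lamPlus_mul_lamMinus]; linarith) (lamPlus_pos β B).le

lemma lamMinus_le_lamPlus (β B : ℝ) : lamMinus β B ≤ lamPlus β B :=
  mul_le_mul_of_nonneg_left (by linarith [Real.sqrt_nonneg (Real.sinh B ^ 2 + Real.exp (-4 * β))])
    (Real.exp_pos β).le

lemma exp_add_lt_lamPlus (β B : ℝ) : Real.exp (β + B) < lamPlus β B := by
  have hsinh : Real.sinh B < √(Real.sinh B ^ 2 + Real.exp (-4 * β)) :=
    Real.lt_sqrt_of_sq_lt (by linarith [Real.exp_pos (-4 * β)])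
  rw [Real.exp_add, lamPlus, ← Real.cosh_add_sinh B]
  gcongr

lemma rRatio_pos (hβ : 0 < β) (B : ℝ) : 0 < rRatio β B :=
  div_pos (lamMinus_pos hβ B) (lamPlus_pos β B)

lemma rRatio_le_one (β B : ℝ) : rRatio β B ≤ 1 :=
  div_le_one_of_le₀ (lamMinus_le_lamPlus β B) (lamPlus_pos β B).le

lemma lamPlus_characteristic (β B : ℝ) :
    (lamPlus β B - Real.exp (β + B)) * (lamPlus β B - Real.exp (β - B)) = Real.exp (-2 * β) := by
  have hdet : Real.exp (β + B) * Real.exp (β - B) = Real.exp (2 * β) := by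
    rw [← Real.exp_add]; ring_nf
  linear_combination lamPlus β B * lamPlus_add_lamMinus β B - lamPlus_mul_lamMinus β B + hdet

/-- Orthogonal diagonalisation of the transfer matrix
`[[exp (β + B), exp (-β)], [exp (-β), exp (β - B)]]`: `(c, s)` and `(s, -c)` are unit eigenvectors
for the eigenvalues `λ₊` and `λ₋`, and `A₊`, `A₋` are read off their overlaps with
`(exp (B / 2), exp (-B / 2))`, the boundary condition at a vertex of degree one. -/
structure IsEigenbasis (β B c s : ℝ) : Prop where
  pos_left : 0 < c
  pos_right : 0 < s
  norm_eq : c ^ 2 + s ^ 2 = 1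
  entry_one_one : lamPlus β B * c ^ 2 + lamMinus β B * s ^ 2 = Real.exp (β + B)
  entry_one_two : (lamPlus β B - lamMinus β B) * (c * s) = Real.exp (-β)
  entry_two_two : lamPlus β B * s ^ 2 + lamMinus β B * c ^ 2 = Real.exp (β - B)
  overlap_plus : APlus β B * lamPlus β B = (c * Real.exp (B / 2) + s * Real.exp (-(B / 2))) ^ 2
  overlap_minus :
    AMinus β B * lamMinus β B = (s * Real.exp (B / 2) - c * Real.exp (-(B / 2))) ^ 2

lemma exists_isEigenbasis (hβ : 0 < β) (B : ℝ) : ∃ c s, IsEigenbasis β B c s := by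
  have hδ : 0 < lamPlus β B - Real.exp (β + B) := sub_pos.2 (exp_add_lt_lamPlus β B)
  have hchar := lamPlus_characteristic β B
  have htrace := lamPlus_add_lamMinus β B
  have hlam := (lamPlus_pos β B).ne'
  have hlam' := (lamMinus_pos hβ B).ne'
  have hε : Real.exp (-2 * β) = Real.exp (-β) ^ 2 := by rw [← Real.exp_nat_mul]; ring_nf
  have hE : Real.exp B = Real.exp (B / 2) ^ 2 := by rw [← Real.exp_nat_mul]; ring_nf
  have hF : Real.exp (-B) = Real.exp (-(B / 2)) ^ 2 := by rw [← Real.exp_nat_mul]; ring_nf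
  have hEF : Real.exp (B / 2) * Real.exp (-(B / 2)) = 1 := by
    rw [← Real.exp_add, add_neg_cancel, Real.exp_zero]
  have hA := APlus.eq_def β B
  have hA' := AMinus.eq_def β B
  rw [hE, hF, hε] at hA hA'
  rw [hε] at hchar
  have hε0 := Real.exp_pos (-β)
  set ε := Real.exp (-β)
  set δ := lamPlus β B - Real.exp (β + B) with hδ_def
  obtain ⟨n, hn0, hn⟩ : ∃ n : ℝ, 0 < n ∧ n ^ 2 = ε ^ 2 + δ ^ 2 :=
    ⟨√(ε ^ 2 + δ ^ 2), Real.sqrt_pos.2 (by positivity), Real.sq_sqrt (by positivity)⟩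
  rw [← hn] at hA hA'
  have hl : lamMinus β B = Real.exp (β - B) - δ := by linear_combination htrace + hδ_def
  have hx : Real.exp (β + B) = lamPlus β B - δ := by linear_combination hδ_def
  refine ⟨ε / n, δ / n, by positivity, by positivity, ?_, ?_, ?_, ?_, ?_, ?_⟩ <;> field_simp
  · exact hn.symm
  · rw [hn, hx, hl]
    linear_combination -δ * hchar
  · rw [hn, hl]
    linear_combination ε * hchar
  · rw [hn, hl]
    linear_combination δ * hchar
  · rw [hA]
    field_simp
    linear_combination -2 * ε * δ * hEF
  · rw [hA']
    field_simp
    linear_combination 2 * ε * δ * hEF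

lemma IsEigenbasis.overlap_minus_eq_zero_iff {B c s : ℝ} (h : IsEigenbasis β B c s) (hβ : 0 < β) :
    s * Real.exp (B / 2) - c * Real.exp (-(B / 2)) = 0 ↔ B = 0 := by
  have hc := h.pos_left
  have hs := h.pos_right
  have hgap : 0 < lamPlus β B - lamMinus β B :=
    pos_of_mul_pos_left (h.entry_one_two ▸ Real.exp_pos (-β)) (by positivity)
  have hdiff : (lamPlus β B - lamMinus β B) * (c ^ 2 - s ^ 2)
      = Real.exp (β + B) - Real.exp (β - B) := by
    linear_combination h.entry_one_one - h.entry_two_two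
  constructor
  · intro hoverlap
    have hratio : c = s * Real.exp B := by
      have hE : Real.exp B = Real.exp (B / 2) * Real.exp (B / 2) := by rw [← Real.exp_add]; ring_nf
      have hEF : Real.exp (B / 2) * Real.exp (-(B / 2)) = 1 := by
        rw [← Real.exp_add, add_neg_cancel, Real.exp_zero]
      linear_combination -s * hE - Real.exp (B / 2) * hoverlap - c * hEF
    have hsinh : (Real.exp β - Real.exp (-β)) * (Real.exp B - Real.exp (-B)) = 0 := by
      have hX : Real.exp B * Real.exp (-B) = 1 := by
        rw [← Real.exp_add, add_neg_cancel, Real.exp_zero]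
      have h12 := h.entry_one_two
      rw [Real.exp_add, sub_eq_add_neg β, Real.exp_add, hratio] at hdiff
      rw [hratio] at h12
      linear_combination -hdiff + (Real.exp B - Real.exp (-B)) * h12
        + (lamPlus β B - lamMinus β B) * s ^ 2 * hX
    rcases mul_eq_zero.1 hsinh with h' | h' <;>
      linarith [Real.exp_injective (sub_eq_zero.1 h')]
  · rintro rfl
    have hcs : c = s := by
      have : c ^ 2 - s ^ 2 = 0 := by simpa [hgap.ne'] using hdiff
      exact (pow_left_inj₀ hc.le hs.le two_ne_zero).1 (sub_eq_zero.1 this)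
    simp [hcs]

lemma APlus_pos (hβ : 0 < β) (B : ℝ) : 0 < APlus β B := by
  obtain ⟨c, s, h⟩ := exists_isEigenbasis hβ B
  have := h.pos_left
  have := h.pos_right
  exact pos_of_mul_pos_left (h.overlap_plus ▸ by positivity) (lamPlus_pos β B).le

lemma AMinus_nonneg (hβ : 0 < β) (B : ℝ) : 0 ≤ AMinus β B := by
  obtain ⟨c, s, h⟩ := exists_isEigenbasis hβ B
  exact nonneg_of_mul_nonneg_left (h.overlap_minus ▸ sq_nonneg _) (lamMinus_pos hβ B)

lemma AMinus_eq_zero_iff (hβ : 0 < β) (B : ℝ) : AMinus β B = 0 ↔ B = 0 := by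
  obtain ⟨c, s, h⟩ := exists_isEigenbasis hβ B
  rw [← h.overlap_minus_eq_zero_iff hβ, ← sq_eq_zero_iff (a := s * _ - _), ← h.overlap_minus,
    mul_eq_zero_iff_right (lamMinus_pos hβ B).ne']

lemma aRatio_nonneg (hβ : 0 < β) (B : ℝ) : 0 ≤ aRatio β B :=
  div_nonneg (AMinus_nonneg hβ B) (APlus_pos hβ B).le

lemma aRatio_eq_zero_iff (hβ : 0 < β) (B : ℝ) : aRatio β B = 0 ↔ B = 0 := by
  rw [aRatio, div_eq_zero_iff, or_iff_left (APlus_pos hβ B).ne', AMinus_eq_zero_iff hβ]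

lemma aRatio_pos (hβ : 0 < β) {B : ℝ} (hB : B ≠ 0) : 0 < aRatio β B :=
  (aRatio_nonneg hβ B).lt_of_ne' (mt (aRatio_eq_zero_iff hβ B).1 hB)

/-- Weights `f b σ` of a spin `σ` at a half-edge of colour `b` such that summing out the colour of
an edge gives its Boltzmann weight, and summing out the spin of a vertex diagonalises the weight
of a vertex of degree two. The numbers `x`, `y` stand for the circle variable of the colours
`true`, `false`. -/
structure IsEdgeFactorization (β B : ℝ) (f : Bool → ℤˣ → ℝ) : Prop where
  edge (σ τ : ℤˣ) : ∑ b, f b σ * f b τ = Real.exp (β * (((σ : ℤ) : ℝ) * ((τ : ℤ) : ℝ)))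
  vertex_one (x y : ℝ) :
    ∑ σ : ℤˣ, Real.exp (B * ((σ : ℤ) : ℝ)) * (f true σ * x + f false σ * y)
      = √(APlus β B) * lamPlus β B * x + √(AMinus β B) * lamMinus β B * y
  vertex_two (x y : ℝ) :
    ∑ σ : ℤˣ, Real.exp (B * ((σ : ℤ) : ℝ)) * (f true σ * x + f false σ * y) ^ 2
      = lamPlus β B * x ^ 2 + lamMinus β B * y ^ 2

/-- The edge factorization obtained from an eigenbasis; the sign `η` of the second eigenvector is
free. -/
noncomputable def edgeFactor (β B c s η : ℝ) (b : Bool) (σ : ℤˣ) : ℝ :=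
  if b then √(lamPlus β B) * if σ = 1 then c * Real.exp (-(B / 2)) else s * Real.exp (B / 2)
  else η * √(lamMinus β B) * if σ = 1 then s * Real.exp (-(B / 2)) else -(c * Real.exp (B / 2))

lemma IsEigenbasis.sum_edgeFactor_mul {B c s η : ℝ} (h : IsEigenbasis β B c s) (hβ : 0 < β)
    (hη : η ^ 2 = 1) (σ τ : ℤˣ) :
    ∑ b, edgeFactor β B c s η b σ * edgeFactor β B c s η b τ
      = Real.exp (β * (((σ : ℤ) : ℝ) * ((τ : ℤ) : ℝ))) := by
  have hsq := Real.sq_sqrt (lamPlus_pos β B).le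
  have hsq' := Real.sq_sqrt (lamMinus_pos hβ B).le
  have h11 : (lamPlus β B * c ^ 2 + lamMinus β B * s ^ 2) * Real.exp (-(B / 2)) ^ 2
      = Real.exp β := by
    rw [h.entry_one_one, ← Real.exp_nat_mul, ← Real.exp_add]
    ring_nf
  have h22 : (lamPlus β B * s ^ 2 + lamMinus β B * c ^ 2) * Real.exp (B / 2) ^ 2
      = Real.exp β := by
    rw [h.entry_two_two, ← Real.exp_nat_mul, ← Real.exp_add]
    ring_nf
  have h12 : (lamPlus β B - lamMinus β B) * (c * s) * (Real.exp (B / 2) * Real.exp (-(B / 2)))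
      = Real.exp (-β) := by
    rw [h.entry_one_two, ← Real.exp_add, add_neg_cancel, Real.exp_zero, mul_one]
  simp only [Fintype.sum_bool, edgeFactor]
  rcases Int.units_eq_one_or σ with rfl | rfl <;> rcases Int.units_eq_one_or τ with rfl | rfl <;>
    simp only [↓reduceIte, neg_units_ne_self, Bool.false_eq_true, mul_neg, neg_mul, neg_neg,
      Units.val_neg, Units.val_one, Int.reduceNeg, Int.cast_neg, Int.cast_one, mul_one]
  · linear_combination h11 + (c * Real.exp (-(B / 2))) ^ 2 * hsq
      + (s * Real.exp (-(B / 2))) ^ 2 * (√(lamMinus β B) ^ 2 * hη + hsq')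
  · linear_combination h12 + c * s * (Real.exp (B / 2) * Real.exp (-(B / 2)))
      * (hsq - √(lamMinus β B) ^ 2 * hη - hsq')
  · linear_combination h12 + c * s * (Real.exp (B / 2) * Real.exp (-(B / 2)))
      * (hsq - √(lamMinus β B) ^ 2 * hη - hsq')
  · linear_combination h22 + (s * Real.exp (B / 2)) ^ 2 * hsq
      + (c * Real.exp (B / 2)) ^ 2 * (√(lamMinus β B) ^ 2 * hη + hsq')

lemma IsEigenbasis.isEdgeFactorization {B c s η : ℝ} (h : IsEigenbasis β B c s) (hβ : 0 < β)
    (hη : η ^ 2 = 1) (hη_nonneg : 0 ≤ η * (s * Real.exp (B / 2) - c * Real.exp (-(B / 2)))) :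
    IsEdgeFactorization β B (edgeFactor β B c s η) := by
  have hc := h.pos_left
  have hs := h.pos_right
  have hl := lamPlus_pos β B
  have hl' := lamMinus_pos hβ B
  have hexp : Real.exp B = Real.exp (B / 2) ^ 2 := by rw [← Real.exp_nat_mul]; ring_nf
  have hexp' : Real.exp (-B) = Real.exp (-(B / 2)) ^ 2 := by rw [← Real.exp_nat_mul]; ring_nf
  have hEF : Real.exp (B / 2) * Real.exp (-(B / 2)) = 1 := by
    rw [← Real.exp_add, add_neg_cancel, Real.exp_zero]
  have hsq := Real.sq_sqrt hl.le
  have hsq' := Real.sq_sqrt hl'.le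
  have hone : √(APlus β B) * lamPlus β B
      = √(lamPlus β B) * (c * Real.exp (B / 2) + s * Real.exp (-(B / 2))) := by
    rw [← sq_eq_sq₀ (by positivity) (by positivity), mul_pow, mul_pow, hsq, ← h.overlap_plus,
      Real.sq_sqrt (APlus_pos hβ B).le]
    ring
  have hone' : √(AMinus β B) * lamMinus β B
      = √(lamMinus β B) * (η * (s * Real.exp (B / 2) - c * Real.exp (-(B / 2)))) := by
    rw [← sq_eq_sq₀ (by positivity) (by positivity), mul_pow, mul_pow, mul_pow η, hη,
      one_mul, hsq', ← h.overlap_minus, Real.sq_sqrt (AMinus_nonneg hβ B)]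
    ring
  refine ⟨h.sum_edgeFactor_mul hβ hη, fun x y => ?_, fun x y => ?_⟩ <;>
    simp only [UnitsInt.univ, Finset.mem_singleton, units_ne_neg_self, not_false_eq_true,
      Finset.sum_insert, Finset.sum_singleton, edgeFactor, ↓reduceIte, neg_units_ne_self,
      Bool.false_eq_true, Units.val_one, Units.val_neg, Int.reduceNeg, Int.cast_neg, Int.cast_one,
      mul_one, mul_neg, hexp, hexp']
  · rw [hone, hone']
    linear_combination (√(lamPlus β B) * x * (c * Real.exp (B / 2) + s * Real.exp (-(B / 2)))
      + η * √(lamMinus β B) * y * (s * Real.exp (B / 2) - c * Real.exp (-(B / 2)))) * hEF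
  · have hunit : (Real.exp (B / 2) * Real.exp (-(B / 2))) ^ 2 * (c ^ 2 + s ^ 2) = 1 := by
      rw [hEF, h.norm_eq, one_pow, one_mul]
    linear_combination (lamPlus β B * x ^ 2 + lamMinus β B * y ^ 2) * hunit
      + (Real.exp (B / 2) * Real.exp (-(B / 2))) ^ 2 * (c ^ 2 + s ^ 2)
        * (x ^ 2 * hsq + y ^ 2 * (√(lamMinus β B) ^ 2 * hη + hsq'))

lemma exists_isEdgeFactorization (hβ : 0 < β) (B : ℝ) : ∃ f, IsEdgeFactorization β B f := by
  obtain ⟨c, s, h⟩ := exists_isEigenbasis hβ B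
  rcases le_total 0 (s * Real.exp (B / 2) - c * Real.exp (-(B / 2))) with hsign | hsign
  · exact ⟨_, h.isEdgeFactorization (η := 1) hβ (one_pow 2) (by rwa [one_mul])⟩
  · exact ⟨_, h.isEdgeFactorization (η := -1) hβ (by norm_num) (by linarith)⟩

end TransferMatrix

/-! ### The partition function as a circle average -/

section PartitionFunction

variable {N : ℕ} {β B p : ℝ}

lemma boltzmannWeight_eq_mul_prod_sqrt {d : Fin N → ℕ} (β B : ℝ) (π : Pairing d)
    (σ : Fin N → ℤˣ) :
    boltzmannWeight β B π σ = (∏ i, Real.exp (B * spin σ i))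
      * ∏ h, √(Real.exp (β * (spin σ h.1 * spin σ (π.1 h).1))) := by
  simp only [boltzmannWeight, edgeSum, totalSpin, ← Real.exp_half, ← Real.exp_sum,
    ← Real.exp_add, Finset.mul_sum]
  rw [add_comm]
  congr 2
  exact Finset.sum_congr rfl fun h _ => by ring

theorem cmExpect_partitionFunction {f : Bool → ℤˣ → ℝ} (hf : IsEdgeFactorization β B f)
    (d : Fin N → ℕ) :
    cmExpect d (partitionFunction β B)
      = (∑ i, d i).doubleFactorial / matchingNumber (∑ i, d i)
        * circleAverage (fun z => ∏ i, ∑ σ : ℤˣ,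
            Real.exp (B * ((σ : ℤ) : ℝ)) * (f true σ * z.re + f false σ * z.im) ^ d i) 0 1 := by
  have hcard : Fintype.card (HalfEdge d) = ∑ i, d i := by simp
  have hmatching : ∀ σ : Fin N → ℤˣ, ∑ π : Pairing d, boltzmannWeight β B π σ
      = (∑ i, d i).doubleFactorial * circleAverage (fun z => ∏ i,
          Real.exp (B * spin σ i) * (f true (σ i) * z.re + f false (σ i) * z.im) ^ d i) 0 1 := by
    intro σ
    have hsum := sum_matching_prod_sqrt (E := HalfEdge d) (fun b h => f b (σ h.1))
      fun h h' => by rw [hf.edge]; positivity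
    simp only [hf.edge, Fintype.prod_sigma, Finset.prod_const, Finset.card_univ,
      Fintype.card_fin, hcard] at hsum
    simp only [boltzmannWeight_eq_mul_prod_sqrt, Finset.prod_mul_distrib, Fintype.prod_sigma,
      ← smul_eq_mul (∏ i, Real.exp (B * spin σ i)), Real.circleAverage_fun_smul,
      ← Finset.smul_sum]
    simp only [smul_eq_mul, spin, hsum]
    ring
  simp only [cmExpect, partitionFunction, card_matching, hcard]
  rw [Finset.sum_comm]
  simp only [hmatching, ← Finset.mul_sum]
  rw [← Real.circleAverage_fun_sum, mul_div_right_comm]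
  · simp only [spin, Fintype.prod_sum]
  · exact fun σ _ => ContinuousOn.circleIntegrable' (by fun_prop)

lemma prod_apply_degree {M : Type*} [CommMonoid M] {d : Fin N → ℕ} (hd : IsOneTwoDegrees p d)
    (g : ℕ → M) :
    ∏ i, g (d i) = g 1 ^ (N - ⌊p * (N : ℝ)⌋₊) * g 2 ^ ⌊p * (N : ℝ)⌋₊ := by
  have hcard := Finset.card_filter_add_card_filter_not (s := Finset.univ) (fun i => d i = 2)
  rw [hd.2, Finset.card_univ, Fintype.card_fin] at hcard
  rw [← Finset.prod_filter_mul_prod_filter_not Finset.univ (fun i => d i = 2) fun i => g (d i),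
    Finset.prod_eq_pow_card (b := g 2) (fun i hi => by rw [(Finset.mem_filter.1 hi).2]),
    Finset.prod_eq_pow_card (b := g 1) (fun i hi => by
      rw [(hd.1 i).resolve_right (Finset.mem_filter.1 hi).2]), hd.2, mul_comm]
  congr 2
  lia

lemma sum_degree {d : Fin N → ℕ} (hd : IsOneTwoDegrees p d) :
    ∑ i, d i = N - ⌊p * (N : ℝ)⌋₊ + 2 * ⌊p * (N : ℝ)⌋₊ := by
  simpa [toAdd_prod, mul_comm] using congrArg Multiplicative.toAdd
    (prod_apply_degree hd Multiplicative.ofAdd)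

end PartitionFunction

/-! ### Entropy -/

/-- The entropy `(x + y) log (x + y) - x log x - y log y`, i.e. the exponential growth rate of the
binomial coefficients `(n (x + y)).choose (n x)`. -/
noncomputable def binaryEntropy (x y : ℝ) : ℝ :=
  Real.negMulLog x + Real.negMulLog y - Real.negMulLog (x + y)

section BinaryEntropy

variable {x y x' y' α β c : ℝ}

lemma mul_log_add_negMulLog_lt (hx : 0 ≤ x) (hα : 0 ≤ α) (hαx : α = 0 → x = 0) (hc : 0 < c)
    (hne : α ≠ c * x) : x * Real.log α + Real.negMulLog x < x * Real.log c + α / c - x := by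
  rcases hx.eq_or_lt with rfl | hx
  · simpa using div_pos (hα.lt_of_ne' (by simpa using hne)) hc
  have hα : 0 < α := hα.lt_of_ne' fun h => hx.ne' (hαx h)
  have hlog := mul_lt_mul_of_pos_left
    (Real.log_lt_sub_one_of_pos (show 0 < α / (c * x) by positivity)
      (by rwa [Ne, div_eq_one_iff_eq (by positivity)])) hx
  rw [Real.log_div hα.ne' (by positivity), Real.log_mul hc.ne' hx.ne',
    show x * (α / (c * x) - 1) = α / c - x by field_simp] at hlog
  rw [Real.negMulLog]
  linarith

lemma binaryEntropy_smul (c x y : ℝ) :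
    binaryEntropy (c * x) (c * y) = c * binaryEntropy x y := by
  simp only [binaryEntropy, ← mul_add, Real.negMulLog_mul]
  ring

lemma mul_log_mul_add_binaryEntropy (hc : c ≠ 0) (x y : ℝ) :
    x * Real.log (c * x) + y * Real.log (c * y) + binaryEntropy x y
      = (x + y) * Real.log (c * (x + y)) := by
  have hlog : ∀ u : ℝ, u * Real.log (c * u) = u * Real.log c - Real.negMulLog u := by
    intro u
    rcases eq_or_ne u 0 with rfl | hu
    · simp
    · rw [Real.log_mul hc hu, Real.negMulLog]
      ring
  rw [hlog, hlog, hlog, binaryEntropy]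
  ring

lemma mul_log_add_binaryEntropy_lt (hx : 0 ≤ x) (hy : 0 ≤ y) (hα : 0 ≤ α) (hβ : 0 ≤ β)
    (hαx : α = 0 → x = 0) (hβy : β = 0 → y = 0) (hne : x * β ≠ y * α) :
    x * Real.log α + y * Real.log β + binaryEntropy x y < (x + y) * Real.log (α + β) := by
  have hxy : 0 < x + y := by
    refine (add_nonneg hx hy).lt_of_ne' fun h => hne ?_
    obtain ⟨rfl, rfl⟩ := (add_eq_zero_iff_of_nonneg hx hy).1 h
    simp
  have hαβ : 0 < α + β := by
    refine (add_nonneg hα hβ).lt_of_ne' fun h => hne ?_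
    obtain ⟨rfl, rfl⟩ := (add_eq_zero_iff_of_nonneg hα hβ).1 h
    simp
  obtain ⟨c, hc, hcxy⟩ : ∃ c, 0 < c ∧ α + β = c * (x + y) :=
    ⟨(α + β) / (x + y), div_pos hαβ hxy, by field_simp⟩
  have hα_ne : α ≠ c * x := fun h => hne <| by
    rw [h, show β = c * y by linear_combination hcxy - h]; ring
  have hβ_ne : β ≠ c * y := fun h => hα_ne (by linear_combination hcxy - h)
  have h1 := mul_log_add_negMulLog_lt hx hα hαx hc hα_ne
  have h2 := mul_log_add_negMulLog_lt hy hβ hβy hc hβ_ne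
  have hdiv : α / c + β / c = x + y := by rw [← add_div, hcxy]; field_simp
  rw [hcxy, Real.log_mul hc.ne' hxy.ne', binaryEntropy, Real.negMulLog.eq_1 (x + y)]
  linarith

lemma mul_log_add_binaryEntropy_le (hx : 0 ≤ x) (hy : 0 ≤ y) (hα : 0 ≤ α) (hβ : 0 ≤ β)
    (hαx : α = 0 → x = 0) (hβy : β = 0 → y = 0) :
    x * Real.log α + y * Real.log β + binaryEntropy x y ≤ (x + y) * Real.log (α + β) := by
  by_cases hne : x * β = y * α
  swap
  · exact (mul_log_add_binaryEntropy_lt hx hy hα hβ hαx hβy hne).le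
  rcases (add_nonneg hx hy).eq_or_lt with h | h
  · obtain ⟨rfl, rfl⟩ := (add_eq_zero_iff_of_nonneg hx hy).1 h.symm
    simp [binaryEntropy]
  obtain ⟨c, hαc, hβc⟩ : ∃ c, α = c * x ∧ β = c * y :=
    ⟨(α + β) / (x + y), by field_simp; linear_combination -hne,
      by field_simp; linear_combination hne⟩
  have hc : c ≠ 0 := by
    rintro rfl
    rw [hαx (by rw [hαc, zero_mul]), hβy (by rw [hβc, zero_mul])] at h
    simp at h
  rw [hαc, hβc, mul_log_mul_add_binaryEntropy hc, mul_add]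

lemma binaryEntropy_add_lt (hx : 0 ≤ x) (hy : 0 ≤ y) (hx' : 0 ≤ x') (hy' : 0 ≤ y')
    (hne : x * y' ≠ y * x') :
    binaryEntropy x y + binaryEntropy x' y' < binaryEntropy (x + x') (y + y') := by
  have hlt := mul_log_add_binaryEntropy_lt hx hy (add_nonneg hx hx') (add_nonneg hy hy')
    (fun h => ((add_eq_zero_iff_of_nonneg hx hx').1 h).1)
    (fun h => ((add_eq_zero_iff_of_nonneg hy hy').1 h).1)
    fun h => hne (by linear_combination h)
  have hle := mul_log_add_binaryEntropy_le hx' hy' (add_nonneg hx hx') (add_nonneg hy hy')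
    (fun h => ((add_eq_zero_iff_of_nonneg hx hx').1 h).2)
    (fun h => ((add_eq_zero_iff_of_nonneg hy hy').1 h).2)
  rw [binaryEntropy.eq_1 (x + x'), add_add_add_comm x]
  simp only [Real.negMulLog]
  rw [add_add_add_comm x] at hlt hle
  linarith

lemma binaryEntropy_add_le (hx : 0 ≤ x) (hy : 0 ≤ y) (hx' : 0 ≤ x') (hy' : 0 ≤ y') :
    binaryEntropy x y + binaryEntropy x' y' ≤ binaryEntropy (x + x') (y + y') := by
  have hle := mul_log_add_binaryEntropy_le hx hy (add_nonneg hx hx') (add_nonneg hy hy')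
    (fun h => ((add_eq_zero_iff_of_nonneg hx hx').1 h).1)
    (fun h => ((add_eq_zero_iff_of_nonneg hy hy').1 h).1)
  have hle' := mul_log_add_binaryEntropy_le hx' hy' (add_nonneg hx hx') (add_nonneg hy hy')
    (fun h => ((add_eq_zero_iff_of_nonneg hx hx').1 h).2)
    (fun h => ((add_eq_zero_iff_of_nonneg hy hy').1 h).2)
  rw [binaryEntropy.eq_1 (x + x'), add_add_add_comm x]
  simp only [Real.negMulLog]
  rw [add_add_add_comm x] at hle hle'
  linarith

lemma binaryEntropy_convex_comb_le (hx : 0 ≤ x) (hy : 0 ≤ y) (hx' : 0 ≤ x') (hy' : 0 ≤ y')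
    {a b : ℝ} (ha : 0 < a) (hb : 0 < b) :
    a * binaryEntropy x y + b * binaryEntropy x' y'
      ≤ binaryEntropy (a * x + b * x') (a * y + b * y') := by
  rw [← binaryEntropy_smul, ← binaryEntropy_smul]
  exact binaryEntropy_add_le (by positivity) (by positivity) (by positivity) (by positivity)

lemma binaryEntropy_convex_comb_lt (hx : 0 ≤ x) (hy : 0 ≤ y) (hx' : 0 ≤ x') (hy' : 0 ≤ y')
    {a b : ℝ} (ha : 0 < a) (hb : 0 < b) (hne : x * y' ≠ y * x') :
    a * binaryEntropy x y + b * binaryEntropy x' y'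
      < binaryEntropy (a * x + b * x') (a * y + b * y') := by
  rw [← binaryEntropy_smul, ← binaryEntropy_smul]
  refine binaryEntropy_add_lt (by positivity) (by positivity) (by positivity) (by positivity)
    fun h => hne (mul_left_cancel₀ (mul_pos ha hb).ne' ?_)
  linear_combination h

end BinaryEntropy

/-! ### The rate function on the rectangle and on the circle -/

/-- The entropic part of `H`, that is, `H` without its two terms linear in `(s, t)`. It is the
growth rate of the combinatorial factor of the terms `(s N, t N)` in an expansion of the circle
average. -/
noncomputable def rectEntropy (p : ℝ) (z : ℝ × ℝ) : ℝ :=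
  2 * binaryEntropy z.1 ((1 - p) / 2 - z.1) + binaryEntropy z.2 (p - z.2)
    - binaryEntropy (z.1 + z.2) ((1 + p) / 2 - z.1 - z.2)

/-- The exponential growth rate of the circle integrand `(x + v y) ^ n₁ * (x² + r y²) ^ n₂` for
`n₁ ~ (1 - p) N` vertices of degree one and `n₂ ~ p N` vertices of degree two. -/
noncomputable def circleRate (p v r x y : ℝ) : ℝ :=
  (1 - p) * Real.log (x + v * y) + p * Real.log (x ^ 2 + r * y ^ 2)

/-- The point of the rectangle that dominates at the point `(x, y)` of the circle. -/
noncomputable def rectPoint (p v r x y : ℝ) : ℝ × ℝ :=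
  ((1 - p) / 2 * (v * y / (x + v * y)), p * (r * y ^ 2 / (x ^ 2 + r * y ^ 2)))

section RateFunction

variable {p v r x y β B : ℝ} {z : ℝ × ℝ}

lemma mem_rect : z ∈ rect p ↔ (0 ≤ z.1 ∧ z.1 ≤ (1 - p) / 2) ∧ 0 ≤ z.2 ∧ z.2 ≤ p := Iff.rfl

lemma isCompact_rect (p : ℝ) : IsCompact (rect p) := isCompact_Icc.prod isCompact_Icc

lemma zero_mem_rect (hp0 : 0 < p) (hp1 : p < 1) : (0 : ℝ × ℝ) ∈ rect p :=
  ⟨⟨le_rfl, by simp only [Prod.fst_zero]; linarith⟩, le_rfl, hp0.le⟩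

lemma H_eq (p β B : ℝ) (z : ℝ × ℝ) :
    H p β B z = rectEntropy p z + z.1 * Real.log (aRatio β B * rRatio β B ^ 2)
      + z.2 * Real.log (rRatio β B) := by
  have hq : z.1 + z.2 + ((1 + p) / 2 - z.1 - z.2) = (1 + p) / 2 := by ring
  simp only [H, rectEntropy, binaryEntropy, Real.negMulLog, add_sub_cancel, hq]
  ring

lemma rectEntropy_eq_add_sub (p : ℝ) (z : ℝ × ℝ) :
    rectEntropy p z = binaryEntropy z.1 ((1 - p) / 2 - z.1) + binaryEntropy z.1 z.2
      + binaryEntropy ((1 - p) / 2 - z.1) (p - z.2) - binaryEntropy ((1 - p) / 2) p := by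
  have hq : z.1 + z.2 + ((1 + p) / 2 - z.1 - z.2) = (1 - p) / 2 + p := by ring
  have hq' : (1 - p) / 2 - z.1 + (p - z.2) = (1 + p) / 2 - z.1 - z.2 := by ring
  simp only [rectEntropy, binaryEntropy, add_sub_cancel, hq, hq']
  ring

lemma continuous_rectEntropy (p : ℝ) : Continuous (rectEntropy p) := by
  unfold rectEntropy binaryEntropy
  fun_prop

lemma continuous_H (p β B : ℝ) : Continuous (H p β B) := by
  have h := continuous_rectEntropy p
  simp only [funext (H_eq p β B)]
  fun_prop

lemma strictConcaveOn_rectEntropy (hp1 : p < 1) :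
    StrictConcaveOn ℝ (rect p) (rectEntropy p) := by
  refine ⟨(convex_Icc _ _).prod (convex_Icc _ _), fun z hz z' hz' hne a b ha hb hab => ?_⟩
  obtain ⟨⟨hs, hsq⟩, ht, htp⟩ := mem_rect.1 hz
  obtain ⟨⟨hs', hsq'⟩, ht', htp'⟩ := mem_rect.1 hz'
  have hcomb : ∀ u x x' : ℝ, u - (a * x + b * x') = a * (u - x) + b * (u - x') :=
    fun u x x' => by linear_combination (-u) * hab
  simp only [rectEntropy_eq_add_sub, smul_eq_mul, Prod.fst_add, Prod.snd_add, Prod.smul_fst,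
    Prod.smul_snd, hcomb]
  set q := (1 - p) / 2
  have hq : 0 < q := by simp only [q]; linarith
  have hconst : a * binaryEntropy q p + b * binaryEntropy q p = binaryEntropy q p := by
    rw [← add_mul, hab, one_mul]
  have h₁ := binaryEntropy_convex_comb_le hs (sub_nonneg.2 hsq) hs' (sub_nonneg.2 hsq') ha hb
  have h₂ := binaryEntropy_convex_comb_le hs ht hs' ht' ha hb
  have h₃ := binaryEntropy_convex_comb_le (sub_nonneg.2 hsq) (sub_nonneg.2 htp)
    (sub_nonneg.2 hsq') (sub_nonneg.2 htp') ha hb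
  rcases ne_or_eq z.1 z'.1 with hss | hss
  · have := binaryEntropy_convex_comb_lt hs (sub_nonneg.2 hsq) hs' (sub_nonneg.2 hsq') ha hb
      fun h => hss (mul_right_cancel₀ hq.ne' (by linear_combination h))
    linarith
  have htt : z.2 ≠ z'.2 := fun h => hne (Prod.ext hss h)
  rcases hs.eq_or_lt with hs0 | hs0
  · have := binaryEntropy_convex_comb_lt (sub_nonneg.2 hsq) (sub_nonneg.2 htp)
      (sub_nonneg.2 hsq') (sub_nonneg.2 htp') ha hb fun h => htt (mul_left_cancel₀ hq.ne' (by
        rw [← hss, ← hs0] at h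
        linear_combination h))
    linarith
  · have := binaryEntropy_convex_comb_lt hs ht hs' ht' ha hb fun h =>
      htt (mul_left_cancel₀ hs0.ne' (by rw [← hss] at h; linear_combination -h))
    linarith

lemma strictConcaveOn_H (hp1 : p < 1) (β B : ℝ) : StrictConcaveOn ℝ (rect p) (H p β B) := by
  refine ⟨(convex_Icc _ _).prod (convex_Icc _ _), fun z hz z' hz' hne a b ha hb hab => ?_⟩
  have := (strictConcaveOn_rectEntropy hp1).2 hz hz' hne ha hb hab
  simp only [H_eq, smul_eq_mul, Prod.fst_add, Prod.snd_add, Prod.smul_fst, Prod.smul_snd] at *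
  linarith

lemma H_zero (p β B : ℝ) : H p β B 0 = 0 := by
  simp [H_eq, rectEntropy_eq_add_sub, binaryEntropy]

lemma H_corner (p β B : ℝ) : H p β B ((1 - p) / 2, p)
    = (1 - p) / 2 * Real.log (aRatio β B * rRatio β B ^ 2) + p * Real.log (rRatio β B) := by
  simp [H_eq, rectEntropy_eq_add_sub, binaryEntropy]

lemma circleRate_one_zero (p v r : ℝ) : circleRate p v r 1 0 = 0 := by simp [circleRate]

lemma circleRate_inv_swap (hv : 0 < v) (hr : 0 < r) (hx : 0 < x) (hy : 0 < y) :
    circleRate p v⁻¹ r⁻¹ y x = circleRate p v r x y - (1 - p) * Real.log v - p * Real.log r := by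
  rw [circleRate, show y + v⁻¹ * x = (x + v * y) / v by field_simp; ring,
    show y ^ 2 + r⁻¹ * x ^ 2 = (x ^ 2 + r * y ^ 2) / r by field_simp; ring,
    Real.log_div (by positivity) hv.ne', Real.log_div (by positivity) hr.ne', circleRate]
  ring

lemma exists_circleRate_pos (hp1 : p < 1) (hv : 0 < v) (r : ℝ) :
    ∃ x y : ℝ, 0 < x ∧ 0 < y ∧ x ^ 2 + y ^ 2 = 1 ∧ 0 < circleRate p v r x y := by
  have hderiv : HasDerivAt (fun θ => circleRate p v r (Real.cos θ) (Real.sin θ))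
      ((1 - p) * v) 0 := by
    have h₁ := (Real.hasDerivAt_cos 0).add ((Real.hasDerivAt_sin 0).const_mul v)
    have h₂ := ((Real.hasDerivAt_cos 0).pow 2).add (((Real.hasDerivAt_sin 0).pow 2).const_mul r)
    refine (((h₁.log (by simp)).const_mul (1 - p)).add ((h₂.log (by simp)).const_mul p)).congr_deriv
      (by simp)
  have hsign := eventually_nhdsWithin_sign_eq_of_deriv_pos
    (by rw [hderiv.deriv]; exact mul_pos (by linarith) hv) (by simp [circleRate_one_zero])
  obtain ⟨θ, hθ, hθ0, hθ1⟩ := ((hsign.filter_mono nhdsWithin_le_nhds).and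
    (Ioo_mem_nhdsGT Real.pi_div_two_pos)).exists
  refine ⟨Real.cos θ, Real.sin θ, Real.cos_pos_of_mem_Ioo ⟨by linarith, hθ1⟩,
    Real.sin_pos_of_pos_of_lt_pi hθ0 (by linarith), Real.cos_sq_add_sin_sq θ, ?_⟩
  rwa [sub_zero, sign_pos hθ0, sign_eq_one_iff] at hθ

lemma rectPoint_mem (hp0 : 0 < p) (hp1 : p < 1) (hv : 0 < v) (hr : 0 < r) (hx : 0 ≤ x)
    (hy : 0 ≤ y) : rectPoint p v r x y ∈ rect p := by
  have hq : 0 ≤ (1 - p) / 2 := by linarith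
  refine ⟨⟨mul_nonneg hq (by positivity), mul_le_of_le_one_right hq ?_⟩,
    mul_nonneg hp0.le (by positivity), mul_le_of_le_one_right hp0.le ?_⟩
  · exact div_le_one_of_le₀ (le_add_of_nonneg_left hx) (by positivity)
  · exact div_le_one_of_le₀ (le_add_of_nonneg_left (sq_nonneg x)) (by positivity)

lemma rectPoint_mem_interior (hp0 : 0 < p) (hp1 : p < 1) (hv : 0 < v) (hr : 0 < r) (hx : 0 < x)
    (hy : 0 < y) : rectPoint p v r x y ∈ interior (rect p) := by
  have hq : 0 < (1 - p) / 2 := by linarith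
  rw [rect, interior_prod_eq, interior_Icc, interior_Icc]
  refine ⟨⟨mul_pos hq (by positivity), mul_lt_of_lt_one_right hq ?_⟩,
    mul_pos hp0 (by positivity), mul_lt_of_lt_one_right hp0 ?_⟩
  · exact (div_lt_one (by positivity)).2 (lt_add_of_pos_left _ hx)
  · exact (div_lt_one (by positivity)).2 (lt_add_of_pos_left _ (by positivity))

/-! ### Duality between the rectangle and the circle -/

lemma binaryEntropy_mul_add (hv : v ≠ 0) (x y : ℝ) :
    binaryEntropy (v * y) x + v * y * Real.log v
      = (x + v * y) * Real.log (x + v * y) - v * y * Real.log y - x * Real.log x := by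
  rcases eq_or_ne y 0 with rfl | hy
  · simp [binaryEntropy, Real.negMulLog]
  · simp only [binaryEntropy, Real.negMulLog, Real.log_mul hv hy, add_comm (v * y) x]
    ring

lemma add_mul_pos (hv : 0 < v) (hx : 0 ≤ x) (hy : 0 ≤ y) (hxy : 0 < x + y) : 0 < x + v * y := by
  rcases hy.eq_or_lt with rfl | hy
  · simpa using hxy
  · positivity

lemma rectEntropy_rectPoint_eq (hv : v ≠ 0) (hr : r ≠ 0) (hF : x + v * y ≠ 0)
    (hG : x ^ 2 + r * y ^ 2 ≠ 0) (hz : z = rectPoint p v r x y) :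
    rectEntropy p z + z.1 * Real.log (v ^ 2) + z.2 * Real.log r
      = circleRate p v r x y - ((z.1 + z.2) * Real.log (y ^ 2)
        + ((1 + p) / 2 - z.1 - z.2) * Real.log (x ^ 2)
        + binaryEntropy (z.1 + z.2) ((1 + p) / 2 - z.1 - z.2)) := by
  obtain ⟨k, hk⟩ : ∃ k, k * (x + v * y) = (1 - p) / 2 := ⟨_, div_mul_cancel₀ _ hF⟩
  obtain ⟨m, hm⟩ : ∃ m, m * (x ^ 2 + r * y ^ 2) = p := ⟨_, div_mul_cancel₀ _ hG⟩
  have hs : z.1 = k * (v * y) := by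
    rw [hz, rectPoint, ← hk]
    field_simp
  have ht : z.2 = m * (r * y ^ 2) := by
    rw [hz, rectPoint]
    field_simp
    linear_combination -y ^ 2 * hm
  have hs' : (1 - p) / 2 - z.1 = k * x := by linear_combination -hk - hs
  have ht' : p - z.2 = m * x ^ 2 := by linear_combination -hm - ht
  have hleaf := binaryEntropy_mul_add hv x y
  have hpath := binaryEntropy_mul_add hr (x ^ 2) (y ^ 2)
  rw [rectEntropy, circleRate, hs', ht', show (1 + p) / 2 - z.1 - z.2 = k * x + m * x ^ 2 by
    linear_combination hs' + ht', hs, ht, binaryEntropy_smul, binaryEntropy_smul]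
  simp only [Real.log_pow] at hpath ⊢
  push_cast at hpath ⊢
  linear_combination 2 * k * hleaf + m * hpath + 2 * Real.log (x + v * y) * hk
    + Real.log (x ^ 2 + r * y ^ 2) * hm

lemma circleRate_le_rectEntropy_rectPoint (hp0 : 0 < p) (hp1 : p < 1) (hv : 0 < v) (hr : 0 < r)
    (hx : 0 ≤ x) (hy : 0 ≤ y) (hxy : x ^ 2 + y ^ 2 = 1) :
    circleRate p v r x y ≤ rectEntropy p (rectPoint p v r x y)
      + (rectPoint p v r x y).1 * Real.log (v ^ 2) + (rectPoint p v r x y).2 * Real.log r := by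
  obtain ⟨⟨hs, hsq⟩, ht, htp⟩ := mem_rect.1 (rectPoint_mem hp0 hp1 hv hr hx hy)
  have hF := add_mul_pos hv hx hy (by nlinarith)
  have hG := add_mul_pos hr (sq_nonneg x) (sq_nonneg y) (hxy ▸ one_pos)
  have hmix := mul_log_add_binaryEntropy_le (add_nonneg hs ht)
    (by linarith : 0 ≤ (1 + p) / 2 - (rectPoint p v r x y).1 - (rectPoint p v r x y).2)
    (sq_nonneg y) (sq_nonneg x)
    (fun h => by simp [rectPoint, pow_eq_zero_iff two_ne_zero |>.1 h])
    (fun h => by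
      obtain rfl := pow_eq_zero_iff two_ne_zero |>.1 h
      simp only [rectPoint, zero_pow two_ne_zero, zero_add] at hF hG ⊢
      rw [div_self hF.ne', div_self hG.ne']
      ring)
  rw [add_comm (y ^ 2), hxy, Real.log_one, mul_zero] at hmix
  rw [rectEntropy_rectPoint_eq hv.ne' hr.ne' hF.ne' hG.ne' rfl]
  linarith

lemma rectEntropy_le_circleRate (hp : -1 < p) (hv : 0 < v) (hr : 0 < r) (hz : z ∈ rect p)
    (hx : 0 < x) (hy : 0 < y) (hx2 : x ^ 2 = ((1 + p) / 2 - z.1 - z.2) / ((1 + p) / 2))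
    (hy2 : y ^ 2 = (z.1 + z.2) / ((1 + p) / 2)) :
    rectEntropy p z + z.1 * Real.log (v ^ 2) + z.2 * Real.log r ≤ circleRate p v r x y := by
  obtain ⟨⟨hs, hsq⟩, ht, htp⟩ := mem_rect.1 hz
  have hk : (1 + p) / 2 ≠ 0 := by linarith
  have hleaf := mul_log_add_binaryEntropy_le hs (sub_nonneg.2 hsq) (by positivity : 0 ≤ v * y)
    hx.le (fun h => absurd h (by positivity)) fun h => absurd h hx.ne'
  have hpath := mul_log_add_binaryEntropy_le ht (sub_nonneg.2 htp)
    (by positivity : 0 ≤ r * y ^ 2) (sq_nonneg x) (fun h => absurd h (by positivity))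
    fun h => absurd h (by positivity)
  have hmix := mul_log_mul_add_binaryEntropy (inv_ne_zero hk) (z.1 + z.2)
    ((1 + p) / 2 - z.1 - z.2)
  rw [inv_mul_eq_div, inv_mul_eq_div, ← hx2, ← hy2,
    show z.1 + z.2 + ((1 + p) / 2 - z.1 - z.2) = (1 + p) / 2 by ring, inv_mul_cancel₀ hk,
    Real.log_one, mul_zero] at hmix
  rw [add_sub_cancel, Real.log_mul hv.ne' hy.ne', add_comm (v * y)] at hleaf
  rw [add_sub_cancel, Real.log_mul hr.ne' (by positivity), add_comm (r * y ^ 2)] at hpath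
  rw [rectEntropy, circleRate]
  simp only [Real.log_pow] at *
  push_cast at *
  linarith

end RateFunction

/-! ### The maximum point -/

/-- The ratio `√(A₋ λ₋²) / √(A₊ λ₊²)` of the two coefficients of the circle integrand at a vertex of
degree one, after division by `λ₊`; it vanishes in zero field. -/
noncomputable def vRatio (β B : ℝ) : ℝ := √(aRatio β B * rRatio β B ^ 2)

/-- The maximum point `(s^*, t^*)` of `H` on the rectangle, maximality being understood in the sense
of `HExt`, for which the maximum point is unique in zero field too. -/
noncomputable def maxPoint (p β B : ℝ) : ℝ × ℝ :=
  Classical.epsilon fun z => z ∈ rect p ∧ ∀ w ∈ rect p, w ≠ z → HExt p β B w < HExt p β B z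

section MaxPoint

variable {p β B : ℝ} {z : ℝ × ℝ}

lemma vRatio_sq (hβ : 0 < β) (B : ℝ) : vRatio β B ^ 2 = aRatio β B * rRatio β B ^ 2 :=
  Real.sq_sqrt (mul_nonneg (aRatio_nonneg hβ B) (sq_nonneg _))

lemma vRatio_pos (hβ : 0 < β) (hB : B ≠ 0) : 0 < vRatio β B :=
  Real.sqrt_pos.2 (mul_pos (aRatio_pos hβ hB) (pow_pos (rRatio_pos hβ B) 2))

lemma vRatio_nonneg (β B : ℝ) : 0 ≤ vRatio β B := Real.sqrt_nonneg _

lemma vRatio_zero_right (hβ : 0 < β) : vRatio β 0 = 0 := by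
  rw [vRatio, (aRatio_eq_zero_iff hβ 0).2 rfl, zero_mul, Real.sqrt_zero]

lemma HExt_of_ne_zero (hβ : 0 < β) (hB : B ≠ 0) (z : ℝ × ℝ) : HExt p β B z = H p β B z :=
  if_neg fun h => (aRatio_pos hβ hB).ne' h.1

lemma HExt_zero_field_lt (hp1 : p < 1) (hβ : 0 < β) (hz : z ∈ rect p) (hne : z ≠ 0) :
    HExt p β 0 z < HExt p β 0 0 := by
  have h0 : HExt p β 0 0 = ((0 : ℝ) : EReal) := by rw [HExt, if_neg (by simp), H_zero]
  obtain ⟨⟨hs, -⟩, ht, htp⟩ := mem_rect.1 hz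
  rw [h0, HExt]
  split_ifs with h
  · exact EReal.bot_lt_coe 0
  have hs0 : z.1 = 0 :=
    hs.antisymm' (not_lt.1 fun hs => h ⟨(aRatio_eq_zero_iff hβ 0).2 rfl, hs⟩)
  have ht0 : 0 < z.2 := ht.lt_of_ne' fun ht => hne (Prod.ext hs0 ht)
  have hent := binaryEntropy_add_lt le_rfl ht (by linarith : 0 ≤ (1 - p) / 2)
    (sub_nonneg.2 htp) (by rw [zero_mul]; exact (mul_pos ht0 (by linarith)).ne)
  have hlog := Real.log_nonpos (rRatio_pos hβ 0).le (rRatio_le_one β 0)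
  rw [zero_add, add_sub_cancel] at hent
  rw [EReal.coe_lt_coe_iff, H_eq, rectEntropy_eq_add_sub, hs0, sub_zero]
  have hS : binaryEntropy 0 ((1 - p) / 2) = 0 := by simp [binaryEntropy]
  linarith [mul_nonpos_of_nonneg_of_nonpos ht hlog]

lemma exists_forall_HExt_lt (hp0 : 0 < p) (hp1 : p < 1) (hβ : 0 < β) (B : ℝ) :
    ∃ z, z ∈ rect p ∧ ∀ w ∈ rect p, w ≠ z → HExt p β B w < HExt p β B z := by
  rcases eq_or_ne B 0 with rfl | hB
  · exact ⟨0, zero_mem_rect hp0 hp1, fun w hw => HExt_zero_field_lt hp1 hβ hw⟩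
  obtain ⟨z, hz, hmax⟩ := (isCompact_rect p).exists_isMaxOn ⟨_, zero_mem_rect hp0 hp1⟩
    (continuous_H p β B).continuousOn
  refine ⟨z, hz, fun w hw hne => ?_⟩
  rw [HExt_of_ne_zero hβ hB, HExt_of_ne_zero hβ hB, EReal.coe_lt_coe_iff]
  refine (hmax hw).lt_of_ne fun heq => hne ?_
  exact (strictConcaveOn_H hp1 β B).eq_of_isMaxOn (fun u hu => (hmax hu).trans heq.ge) hmax hw hz

lemma maxPoint_spec (hp0 : 0 < p) (hp1 : p < 1) (hβ : 0 < β) (B : ℝ) :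
    maxPoint p β B ∈ rect p ∧
      ∀ w ∈ rect p, w ≠ maxPoint p β B → HExt p β B w < HExt p β B (maxPoint p β B) :=
  Classical.epsilon_spec (exists_forall_HExt_lt hp0 hp1 hβ B)

lemma maxPoint_mem (hp0 : 0 < p) (hp1 : p < 1) (hβ : 0 < β) (B : ℝ) : maxPoint p β B ∈ rect p :=
  (maxPoint_spec hp0 hp1 hβ B).1

lemma maxPoint_zero (hp0 : 0 < p) (hp1 : p < 1) (hβ : 0 < β) : maxPoint p β 0 = 0 := by
  by_contra hne
  obtain ⟨hmem, hmax⟩ := maxPoint_spec hp0 hp1 hβ 0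
  exact lt_asymm (hmax 0 (zero_mem_rect hp0 hp1) (Ne.symm hne)) (HExt_zero_field_lt hp1 hβ hmem hne)

lemma H_lt_H_maxPoint (hp0 : 0 < p) (hp1 : p < 1) (hβ : 0 < β) (hB : B ≠ 0) (hz : z ∈ rect p)
    (hne : z ≠ maxPoint p β B) : H p β B z < H p β B (maxPoint p β B) := by
  simpa only [HExt_of_ne_zero hβ hB, EReal.coe_lt_coe_iff] using
    (maxPoint_spec hp0 hp1 hβ B).2 z hz hne

lemma isMaxOn_H_maxPoint (hp0 : 0 < p) (hp1 : p < 1) (hβ : 0 < β) (hB : B ≠ 0) :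
    IsMaxOn (H p β B) (rect p) (maxPoint p β B) := fun z hz => by
  rcases eq_or_ne z (maxPoint p β B) with rfl | hne
  · exact le_refl (H p β B _)
  · exact (H_lt_H_maxPoint hp0 hp1 hβ hB hz hne).le

lemma circleRate_le_H_maxPoint_of_ne_zero (hp0 : 0 < p) (hp1 : p < 1) (hβ : 0 < β) (hB : B ≠ 0)
    {x y : ℝ} (hx : 0 ≤ x) (hy : 0 ≤ y) (hxy : x ^ 2 + y ^ 2 = 1) :
    circleRate p (vRatio β B) (rRatio β B) x y ≤ H p β B (maxPoint p β B) := by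
  have hv := vRatio_pos hβ hB
  have hr := rRatio_pos hβ B
  refine (circleRate_le_rectEntropy_rectPoint hp0 hp1 hv hr hx hy hxy).trans ?_
  rw [vRatio_sq hβ, ← H_eq]
  exact isMaxOn_H_maxPoint hp0 hp1 hβ hB (rectPoint_mem hp0 hp1 hv hr hx hy)

lemma maxPoint_ne_zero (hp0 : 0 < p) (hp1 : p < 1) (hβ : 0 < β) (hB : B ≠ 0) :
    maxPoint p β B ≠ 0 := fun h => by
  obtain ⟨x, y, hx, hy, hxy, hpos⟩ := exists_circleRate_pos hp1 (vRatio_pos hβ hB) (rRatio β B)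
  have hle := circleRate_le_H_maxPoint_of_ne_zero hp0 hp1 hβ hB hx.le hy.le hxy
  rw [h, H_zero] at hle
  linarith

lemma maxPoint_ne_corner (hp0 : 0 < p) (hp1 : p < 1) (hβ : 0 < β) (hB : B ≠ 0) :
    maxPoint p β B ≠ ((1 - p) / 2, p) := fun h => by
  have hv := vRatio_pos hβ hB
  have hr := rRatio_pos hβ B
  obtain ⟨y, x, hy, hx, hxy, hpos⟩ := exists_circleRate_pos hp1 (inv_pos.2 hv) (rRatio β B)⁻¹
  rw [circleRate_inv_swap hv hr hx hy] at hpos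
  have hle := circleRate_le_H_maxPoint_of_ne_zero hp0 hp1 hβ hB hx.le hy.le (by rw [add_comm, hxy])
  rw [h, H_corner, ← vRatio_sq hβ, Real.log_pow] at hle
  push_cast at hle
  linarith

lemma exists_H_maxPoint_le_circleRate_of_ne_zero (hp0 : 0 < p) (hp1 : p < 1) (hβ : 0 < β)
    (hB : B ≠ 0) :
    ∃ x y : ℝ, 0 < x ∧ 0 < y ∧ x ^ 2 + y ^ 2 = 1 ∧
      H p β B (maxPoint p β B) ≤ circleRate p (vRatio β B) (rRatio β B) x y := by
  have hmem := maxPoint_mem hp0 hp1 hβ B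
  have h0 := maxPoint_ne_zero hp0 hp1 hβ hB
  have hcorner := maxPoint_ne_corner hp0 hp1 hβ hB
  rw [H_eq, ← vRatio_sq hβ]
  obtain ⟨⟨hs, hsq⟩, ht, htp⟩ := mem_rect.1 hmem
  set z := maxPoint p β B
  have hk : 0 < (1 + p) / 2 := by linarith
  have hst : 0 < z.1 + z.2 := (add_nonneg hs ht).lt_of_ne' fun h =>
    h0 (Prod.ext_iff.2 ((add_eq_zero_iff_of_nonneg hs ht).1 h))
  have hst' : 0 < (1 + p) / 2 - z.1 - z.2 := by
    refine (by linarith : 0 ≤ (1 + p) / 2 - z.1 - z.2).lt_of_ne' fun h => hcorner ?_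
    exact Prod.ext (hsq.antisymm (by linarith)) (htp.antisymm (by linarith))
  have hx2 := Real.sq_sqrt (div_pos hst' hk).le
  have hy2 := Real.sq_sqrt (div_pos hst hk).le
  refine ⟨_, _, Real.sqrt_pos.2 (div_pos hst' hk), Real.sqrt_pos.2 (div_pos hst hk), ?_,
    rectEntropy_le_circleRate (by linarith) (vRatio_pos hβ hB) (rRatio_pos hβ B) hmem
      (Real.sqrt_pos.2 (div_pos hst' hk)) (Real.sqrt_pos.2 (div_pos hst hk)) hx2 hy2⟩
  rw [hx2, hy2]
  field_simp
  ring

lemma maxPoint_mem_interior (hp0 : 0 < p) (hp1 : p < 1) (hβ : 0 < β) (hB : B ≠ 0) :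
    maxPoint p β B ∈ interior (rect p) := by
  have hv := vRatio_pos hβ hB
  have hr := rRatio_pos hβ B
  obtain ⟨x, y, hx, hy, hxy, hle⟩ := exists_H_maxPoint_le_circleRate_of_ne_zero hp0 hp1 hβ hB
  have hdual := hle.trans (circleRate_le_rectEntropy_rectPoint hp0 hp1 hv hr hx.le hy.le hxy)
  rw [vRatio_sq hβ, ← H_eq] at hdual
  have heq : rectPoint p (vRatio β B) (rRatio β B) x y = maxPoint p β B := by
    by_contra hne
    exact hdual.not_gt (H_lt_H_maxPoint hp0 hp1 hβ hB (rectPoint_mem hp0 hp1 hv hr hx.le hy.le) hne)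
  exact heq ▸ rectPoint_mem_interior hp0 hp1 hv hr hx hy

lemma circleRate_le_mul_sq (hp0 : 0 < p) (hp1 : p < 1) {v r x y : ℝ} (hv : 0 ≤ v) (hr : 0 ≤ r)
    (hr1 : r ≤ 1) (hx : 0 ≤ x) (hy : 0 ≤ y) (hxy : x ^ 2 + y ^ 2 = 1) :
    circleRate p v r x y ≤ (1 - p) / 2 * v ^ 2 := by
  have hleaf : Real.log ((x + v * y) ^ 2) ≤ v ^ 2 := by
    rcases (by positivity : 0 ≤ x + v * y).eq_or_lt with h | h
    · simpa [← h] using sq_nonneg v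
    · have := Real.log_le_sub_one_of_pos (pow_pos h 2)
      nlinarith [sq_nonneg (v * x - y)]
  rw [Real.log_pow] at hleaf
  push_cast at hleaf
  have hpath : Real.log (x ^ 2 + r * y ^ 2) ≤ 0 :=
    Real.log_nonpos (by positivity) (by nlinarith [sq_nonneg y])
  rw [circleRate]
  nlinarith

lemma circleRate_le_H_maxPoint (hp0 : 0 < p) (hp1 : p < 1) (hβ : 0 < β) (B : ℝ) {x y : ℝ}
    (hx : 0 ≤ x) (hy : 0 ≤ y) (hxy : x ^ 2 + y ^ 2 = 1) :
    circleRate p (vRatio β B) (rRatio β B) x y ≤ H p β B (maxPoint p β B) := by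
  rcases eq_or_ne B 0 with rfl | hB
  · rw [maxPoint_zero hp0 hp1 hβ, H_zero, vRatio_zero_right hβ]
    simpa using
      circleRate_le_mul_sq hp0 hp1 le_rfl (rRatio_pos hβ 0).le (rRatio_le_one β 0) hx hy hxy
  · exact circleRate_le_H_maxPoint_of_ne_zero hp0 hp1 hβ hB hx hy hxy

lemma exists_H_maxPoint_le_circleRate (hp0 : 0 < p) (hp1 : p < 1) (hβ : 0 < β) (B : ℝ) :
    ∃ x y : ℝ, 0 < x ∧ 0 ≤ y ∧ x ^ 2 + y ^ 2 = 1 ∧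
      H p β B (maxPoint p β B) ≤ circleRate p (vRatio β B) (rRatio β B) x y := by
  rcases eq_or_ne B 0 with rfl | hB
  · refine ⟨1, 0, one_pos, le_rfl, by norm_num, ?_⟩
    rw [maxPoint_zero hp0 hp1 hβ, H_zero, circleRate_one_zero]
  · obtain ⟨x, y, hx, hy, h⟩ := exists_H_maxPoint_le_circleRate_of_ne_zero hp0 hp1 hβ hB
    exact ⟨x, y, hx, hy.le, h⟩

end MaxPoint

/-! ### Laplace's method on the circle -/

section Laplace

lemma circleAverage_pos {f : ℂ → ℝ} (hf : Continuous f)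
    (hnonneg : ∀ z ∈ Metric.sphere (0 : ℂ) 1, 0 ≤ f z) {z₀ : ℂ}
    (hz₀ : z₀ ∈ Metric.sphere (0 : ℂ) 1) (hpos : 0 < f z₀) : 0 < circleAverage f 0 1 := by
  obtain ⟨θ, hθ, rfl⟩ : z₀ ∈ circleMap 0 1 '' Set.Ioc 0 (2 * Real.pi) := by
    rwa [image_circleMap_Ioc, abs_one]
  rw [Real.circleAverage_def]
  refine smul_pos (by positivity) (intervalIntegral.integral_pos Real.two_pi_pos
    (by fun_prop) (fun θ _ => hnonneg _ (by simp)) ⟨θ, Set.Ioc_subset_Icc_self hθ, hpos⟩)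

lemma exists_mul_le_circleAverage {z₀ : ℂ} (hz₀ : z₀ ∈ Metric.sphere (0 : ℂ) 1) {U : Set ℂ}
    (hU : U ∈ 𝓝 z₀) :
    ∃ κ > 0, ∀ (f : ℂ → ℝ) (a : ℝ), Continuous f → 0 ≤ a →
      (∀ z ∈ Metric.sphere (0 : ℂ) 1, 0 ≤ f z) → (∀ z ∈ U ∩ Metric.sphere (0 : ℂ) 1, a ≤ f z) →
      κ * a ≤ circleAverage f 0 1 := by
  obtain ⟨δ, hδ, hball⟩ := Metric.mem_nhds_iff.1 hU
  let bump : ℂ → ℝ := fun z => max 0 (1 - dist z z₀ / δ)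
  have hbump : Continuous bump := by fun_prop
  refine ⟨circleAverage bump 0 1,
    circleAverage_pos hbump (fun z _ => le_max_left _ _) hz₀ (by simp [bump]), ?_⟩
  intro f a hf ha hnonneg hle
  rw [mul_comm, ← smul_eq_mul, ← Real.circleAverage_fun_smul]
  refine Real.circleAverage_mono (Continuous.continuousOn (by fun_prop)).circleIntegrable'
    hf.continuousOn.circleIntegrable' fun z hz => ?_
  rw [abs_one] at hz
  by_cases hzU : z ∈ U
  · refine (mul_le_of_le_one_right ha (max_le zero_le_one ?_)).trans (hle z ⟨hzU, hz⟩)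
    exact sub_le_self _ (by positivity)
  · have hdist : δ ≤ dist z z₀ := not_lt.1 fun h => hzU (hball h)
    have hzero : bump z = 0 :=
      max_eq_left (sub_nonpos.2 ((one_le_div hδ).2 hdist))
    simpa only [hzero, smul_zero] using hnonneg z hz

lemma tendsto_log_circleAverage_div {l : Filter ℕ} (hl : l ≤ atTop) {W : ℕ → ℂ → ℝ} {h : ℝ}
    {z₀ : ℂ} (hz₀ : z₀ ∈ Metric.sphere (0 : ℂ) 1) (hW : ∀ N, Continuous (W N))
    (hnonneg : ∀ᶠ N in l, ∀ z ∈ Metric.sphere (0 : ℂ) 1, 0 ≤ W N z)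
    (hle : ∀ ε > 0, ∀ᶠ N : ℕ in l, ∀ z ∈ Metric.sphere (0 : ℂ) 1, W N z ≤ Real.exp (N * (h + ε)))
    (hge : ∀ ε > 0, ∃ U ∈ 𝓝 z₀, ∀ᶠ N : ℕ in l, ∀ z ∈ U ∩ Metric.sphere (0 : ℂ) 1,
      Real.exp (N * (h - ε)) ≤ W N z) :
    (∀ᶠ N in l, 0 < circleAverage (W N) 0 1) ∧
      Tendsto (fun N : ℕ => Real.log (circleAverage (W N) 0 1) / N) l (𝓝 h) := by
  have hlower : ∀ ε > 0, ∃ κ > 0, ∀ᶠ N : ℕ in l,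
      κ * Real.exp (N * (h - ε)) ≤ circleAverage (W N) 0 1 := fun ε hε => by
    obtain ⟨U, hU, hUW⟩ := hge ε hε
    obtain ⟨κ, hκ, hκle⟩ := exists_mul_le_circleAverage hz₀ hU
    refine ⟨κ, hκ, ?_⟩
    filter_upwards [hUW, hnonneg] with N hN hN0
    exact hκle _ _ (hW N) (Real.exp_pos _).le hN0 hN
  have hpos : ∀ᶠ N in l, 0 < circleAverage (W N) 0 1 := by
    obtain ⟨κ, hκ, hκle⟩ := hlower 1 one_pos
    filter_upwards [hκle] with N hN
    exact (by positivity : 0 < κ * Real.exp (N * (h - 1))).trans_le hN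
  have hN0 : ∀ᶠ N : ℕ in l, (0 : ℝ) < N :=
    hl ((eventually_gt_atTop 0).mono fun N hN => Nat.cast_pos.2 hN)
  refine ⟨hpos, tendsto_order.2 ⟨fun a ha => ?_, fun a ha => ?_⟩⟩
  · obtain ⟨κ, hκ, hκle⟩ := hlower ((h - a) / 2) (by linarith)
    have hconst := ((tendsto_const_div_atTop_nhds_zero_nat (Real.log κ)).mono_left hl).eventually
      (lt_mem_nhds (by linarith : -((h - a) / 2) < 0))
    filter_upwards [hκle, hconst, hN0] with N hN hlog hN0
    have := Real.log_le_log (by positivity) hN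
    rw [Real.log_mul hκ.ne' (Real.exp_ne_zero _), Real.log_exp] at this
    rw [lt_div_iff₀ hN0] at hlog ⊢
    linarith
  · filter_upwards [hle ((a - h) / 2) (by linarith), hpos, hN0] with N hN hpos hN0
    have havg : circleAverage (W N) 0 1 ≤ Real.exp (N * (h + (a - h) / 2)) :=
      Real.circleAverage_mono_on_of_le_circle (hW N).continuousOn.circleIntegrable'
        (by simpa only [abs_one] using hN)
    have := (Real.log_le_iff_le_exp hpos).2 havg
    rw [div_lt_iff₀ hN0]
    nlinarith

end Laplace

/-! ### The limit of the annealed pressure -/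

/-- The limit `ψ̃(β, B)` of the annealed pressure. -/
noncomputable def pressure (p β B : ℝ) : ℝ :=
  Real.log (lamPlus β B) + (1 - p) / 2 * Real.log (APlus β B) + H p β B (maxPoint p β B)

/-- The circle integrand for graphs of size `N`, divided by its value at `1`. -/
noncomputable def circleWeight (p v r : ℝ) (N : ℕ) (z : ℂ) : ℝ :=
  (z.re + v * z.im) ^ (N - ⌊p * (N : ℝ)⌋₊) * (z.re ^ 2 + r * z.im ^ 2) ^ ⌊p * (N : ℝ)⌋₊

section Limit

variable {p β v r : ℝ} {N : ℕ}

lemma continuous_circleWeight (p v r : ℝ) (N : ℕ) : Continuous (circleWeight p v r N) := by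
  unfold circleWeight
  fun_prop

lemma natFloor_mul_lt (hp0 : 0 < p) (hp1 : p < 1) (hN : 0 < N) : ⌊p * (N : ℝ)⌋₊ < N := by
  rw [Nat.floor_lt (by positivity)]
  exact mul_lt_of_lt_one_left (by positivity) hp1

lemma mul_sub_natFloor_mem_Icc (hp0 : 0 < p) (N : ℕ) :
    p * N - ⌊p * (N : ℝ)⌋₊ ∈ Set.Icc (0 : ℝ) 1 :=
  ⟨sub_nonneg.2 (Nat.floor_le (by positivity)),
    sub_le_iff_le_add'.2 (Nat.lt_floor_add_one _).le⟩

lemma pow_mul_pow_natFloor_eq_exp (hp0 : 0 < p) (hp1 : p < 1) (hN : 0 < N) {F G : ℝ} (hF : 0 < F)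
    (hG : 0 < G) :
    F ^ (N - ⌊p * (N : ℝ)⌋₊) * G ^ ⌊p * (N : ℝ)⌋₊
      = Real.exp (N * ((1 - p) * Real.log F + p * Real.log G)
        + (p * N - ⌊p * (N : ℝ)⌋₊) * (Real.log F - Real.log G)) := by
  rw [← Real.exp_log (by positivity : 0 < F ^ (N - ⌊p * (N : ℝ)⌋₊) * G ^ ⌊p * (N : ℝ)⌋₊),
    Real.log_mul (by positivity) (by positivity), Real.log_pow, Real.log_pow,
    Nat.cast_sub (natFloor_mul_lt hp0 hp1 hN).le]
  ring_nf

lemma even_card_degree_one {d : Fin N → ℕ} (hd : IsOneTwoDegrees p d) (heven : Even (∑ i, d i)) :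
    Even (N - ⌊p * (N : ℝ)⌋₊) := by
  rwa [sum_degree hd, Nat.even_add, iff_true_right (even_two_mul _)] at heven

lemma circleWeight_le_exp (hp0 : 0 < p) (hp1 : p < 1) (hN : 0 < N)
    (heven : Even (N - ⌊p * (N : ℝ)⌋₊)) (hv : 0 ≤ v) (hr0 : 0 < r) (hr1 : r ≤ 1) {h : ℝ}
    (hrate : ∀ x y : ℝ, 0 ≤ x → 0 ≤ y → x ^ 2 + y ^ 2 = 1 → circleRate p v r x y ≤ h) {z : ℂ}
    (hz : z ∈ Metric.sphere (0 : ℂ) 1) :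
    circleWeight p v r N z ≤ Real.exp (N * h + (Real.log (1 + v) - Real.log r)) := by
  have hz := re_sq_add_im_sq_of_mem_sphere hz
  have hG : r ≤ z.re ^ 2 + r * z.im ^ 2 := by nlinarith [sq_nonneg z.re]
  have hx : |z.re| ≤ 1 := abs_le_one_iff_mul_self_le_one.2 (by nlinarith [sq_nonneg z.im])
  have hy : |z.im| ≤ 1 := abs_le_one_iff_mul_self_le_one.2 (by nlinarith [sq_nonneg z.re])
  have hF : |z.re + v * z.im| ≤ |z.re| + v * |z.im| := by
    simpa only [abs_mul, abs_of_nonneg hv] using abs_add_le z.re (v * z.im)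
  rw [circleWeight, ← heven.pow_abs]
  refine (mul_le_mul_of_nonneg_right (pow_le_pow_left₀ (abs_nonneg _) hF _)
    (by positivity)).trans ?_
  rcases (by positivity : 0 ≤ |z.re| + v * |z.im|).eq_or_lt with hF0 | hF0
  · rw [← hF0, zero_pow (Nat.sub_pos_of_lt (natFloor_mul_lt hp0 hp1 hN)).ne', zero_mul]
    positivity
  rw [pow_mul_pow_natFloor_eq_exp hp0 hp1 hN hF0 (hr0.trans_le hG), Real.exp_le_exp]
  have hrate := hrate |z.re| |z.im| (abs_nonneg _) (abs_nonneg _) (by simpa only [sq_abs] using hz)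
  rw [circleRate, sq_abs, sq_abs] at hrate
  have hlogF : Real.log (|z.re| + v * |z.im|) ≤ Real.log (1 + v) :=
    Real.log_le_log hF0 (by nlinarith)
  have hlogG := Real.log_le_log hr0 hG
  have hlogv : 0 ≤ Real.log (1 + v) := Real.log_nonneg (by linarith)
  have hlogr : Real.log r ≤ 0 := Real.log_nonpos hr0.le hr1
  obtain ⟨hθ0, hθ1⟩ := mul_sub_natFloor_mem_Icc hp0 N
  refine add_le_add (mul_le_mul_of_nonneg_left hrate N.cast_nonneg) ?_
  calc (p * N - ⌊p * (N : ℝ)⌋₊) * (Real.log (|z.re| + v * |z.im|) -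
        Real.log (z.re ^ 2 + r * z.im ^ 2))
      ≤ (p * N - ⌊p * (N : ℝ)⌋₊) * (Real.log (1 + v) - Real.log r) := by gcongr
    _ ≤ Real.log (1 + v) - Real.log r := mul_le_of_le_one_left (by linarith) hθ1

lemma exists_exp_le_circleWeight (hp0 : 0 < p) (hp1 : p < 1) {h : ℝ} {z₀ : ℂ}
    (hF : 0 < z₀.re + v * z₀.im) (hG : 0 < z₀.re ^ 2 + r * z₀.im ^ 2)
    (hrate : h < circleRate p v r z₀.re z₀.im) :
    ∃ c : ℝ, ∃ U ∈ 𝓝 z₀, ∀ N : ℕ, 0 < N → ∀ z ∈ U,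
      Real.exp (N * h - c) ≤ circleWeight p v r N z := by
  have hFcont : ContinuousAt (fun z : ℂ => z.re + v * z.im) z₀ := by fun_prop
  have hGcont : ContinuousAt (fun z : ℂ => z.re ^ 2 + r * z.im ^ 2) z₀ := by fun_prop
  have hlogF := hFcont.log hF.ne'
  have hlogG := hGcont.log hG.ne'
  set c := Real.log (z₀.re + v * z₀.im) - Real.log (z₀.re ^ 2 + r * z₀.im ^ 2) - 1
  refine ⟨|c|, _, inter_mem (inter_mem (hFcont.eventually (lt_mem_nhds hF))
    (hGcont.eventually (lt_mem_nhds hG))) (inter_mem ((hlogF.sub hlogG).eventually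
      (lt_mem_nhds (sub_one_lt _))) (((hlogF.const_mul (1 - p)).add
        (hlogG.const_mul p)).eventually (lt_mem_nhds hrate))), fun N hN z hz => ?_⟩
  obtain ⟨⟨hFz, hGz⟩, hcz, hratez⟩ := hz
  rw [circleWeight, pow_mul_pow_natFloor_eq_exp hp0 hp1 hN hFz hGz, Real.exp_le_exp,
    sub_eq_add_neg]
  obtain ⟨hθ0, hθ1⟩ := mul_sub_natFloor_mem_Icc hp0 N
  refine add_le_add (mul_le_mul_of_nonneg_left (le_of_lt hratez) N.cast_nonneg) ?_
  calc -|c| ≤ (p * N - ⌊p * (N : ℝ)⌋₊) * -|c| := by nlinarith [abs_nonneg c]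
    _ ≤ _ := mul_le_mul_of_nonneg_left ((neg_abs_le c).trans (le_of_lt hcz)) hθ0

lemma eventually_evenSizes (d : (N : ℕ) → Fin N → ℕ) :
    ∀ᶠ N in evenSizes d, 0 < N ∧ Even (∑ i, d N i) :=
  ((eventually_gt_atTop 0).filter_mono inf_le_left).and (mem_inf_of_right (mem_principal_self _))

lemma eventually_add_le_mul {l : Filter ℕ} (hl : l ≤ atTop) (c : ℝ) {h h' : ℝ} (hh : h < h') :
    ∀ᶠ N : ℕ in l, N * h + c ≤ N * h' := by
  filter_upwards [(tendsto_natCast_atTop_atTop.mono_left hl).eventually_ge_atTop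
    (c / (h' - h))] with N hN
  rw [div_le_iff₀ (sub_pos.2 hh)] at hN
  linarith

lemma tendsto_log_circleAverage_circleWeight (hp0 : 0 < p) (hp1 : p < 1)
    (d : (N : ℕ) → Fin N → ℕ) (hd : ∀ N, IsOneTwoDegrees p (d N)) (hβ : 0 < β) (B : ℝ) :
    (∀ᶠ N in evenSizes d,
        0 < circleAverage (circleWeight p (vRatio β B) (rRatio β B) N) 0 1) ∧
      Tendsto (fun N : ℕ =>
          Real.log (circleAverage (circleWeight p (vRatio β B) (rRatio β B) N) 0 1) / N)
        (evenSizes d) (𝓝 (H p β B (maxPoint p β B))) := by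
  obtain ⟨x, y, hx, hy, hxy, hrate⟩ := exists_H_maxPoint_le_circleRate hp0 hp1 hβ B
  have hl : evenSizes d ≤ atTop := inf_le_left
  have hv := vRatio_nonneg β B
  have hr := rRatio_pos hβ B
  have hz₀ : (⟨x, y⟩ : ℂ) ∈ Metric.sphere (0 : ℂ) 1 := by
    rw [mem_sphere_zero_iff_norm, Complex.norm_def, Complex.normSq_mk, ← pow_two, ← pow_two, hxy,
      Real.sqrt_one]
  refine tendsto_log_circleAverage_div hl hz₀ (continuous_circleWeight p _ _) ?_
    (fun ε hε => ?_) fun ε hε => ?_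
  · filter_upwards [eventually_evenSizes d] with N hN z _
    exact mul_nonneg ((even_card_degree_one (hd N) hN.2).pow_nonneg _) (by positivity)
  · filter_upwards [eventually_evenSizes d, eventually_add_le_mul hl _ (lt_add_of_pos_right _ hε)]
      with N hN hε z hz
    exact (circleWeight_le_exp hp0 hp1 hN.1 (even_card_degree_one (hd N) hN.2) hv hr
      (rRatio_le_one β B) (fun x y hx hy => circleRate_le_H_maxPoint hp0 hp1 hβ B hx hy) hz).trans
      (Real.exp_le_exp.2 hε)
  · obtain ⟨c, U, hU, hUle⟩ := exists_exp_le_circleWeight (z₀ := ⟨x, y⟩) hp0 hp1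
      (show 0 < x + vRatio β B * y by positivity)
      (show 0 < x ^ 2 + rRatio β B * y ^ 2 by positivity)
      ((sub_lt_self _ (half_pos hε)).trans_le hrate)
    refine ⟨U, hU, ?_⟩
    filter_upwards [eventually_evenSizes d, eventually_add_le_mul hl c
      (sub_lt_sub_left (half_lt_self hε) (H p β B (maxPoint p β B)))] with N hN hε z hz
    exact (Real.exp_le_exp.2 (le_sub_iff_add_le.2 hε)).trans (hUle N hN.1 z hz.1)

lemma cmExpect_partitionFunction_eq_circleWeight (hβ : 0 < β) (B : ℝ) {d : Fin N → ℕ}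
    (hd : IsOneTwoDegrees p d) :
    cmExpect d (partitionFunction β B)
      = (∑ i, d i).doubleFactorial / matchingNumber (∑ i, d i)
        * ((√(APlus β B) * lamPlus β B) ^ (N - ⌊p * (N : ℝ)⌋₊) * lamPlus β B ^ ⌊p * (N : ℝ)⌋₊
          * circleAverage (circleWeight p (vRatio β B) (rRatio β B) N) 0 1) := by
  obtain ⟨f, hf⟩ := exists_isEdgeFactorization hβ B
  have hl := lamPlus_pos β B
  have hA := Real.sqrt_pos.2 (APlus_pos hβ B)
  have hleaf : √(AMinus β B) * lamMinus β B = √(APlus β B) * lamPlus β B * vRatio β B := by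
    rw [vRatio, Real.sqrt_mul (aRatio_nonneg hβ B), Real.sqrt_sq (rRatio_pos hβ B).le, aRatio,
      Real.sqrt_div (AMinus_nonneg hβ B), rRatio]
    field_simp
  have hpath : lamMinus β B = lamPlus β B * rRatio β B := by
    rw [rRatio, mul_div_cancel₀ _ hl.ne']
  rw [cmExpect_partitionFunction hf, ← smul_eq_mul (_ * _) (circleAverage _ _ _),
    ← Real.circleAverage_fun_smul]
  congr 2
  ext z
  rw [prod_apply_degree hd fun k => ∑ σ : ℤˣ, Real.exp (B * ((σ : ℤ) : ℝ))
    * (f true σ * z.re + f false σ * z.im) ^ k, hf.vertex_two]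
  simp only [pow_one]
  rw [hf.vertex_one, hleaf, hpath, circleWeight, smul_eq_mul, mul_mul_mul_comm, ← mul_pow,
    ← mul_pow]
  ring_nf

lemma sum_degree_le {d : Fin N → ℕ} (hd : IsOneTwoDegrees p d) : ∑ i, d i ≤ 2 * N :=
  (Finset.sum_le_card_nsmul Finset.univ d 2 fun i _ => by rcases hd.1 i with h | h <;> lia).trans_eq
    (by simp [mul_comm])

lemma tendsto_log_two_mul_add_one_div :
    Tendsto (fun N : ℕ => Real.log (2 * N + 1) / N) atTop (𝓝 0) := by
  refine ((Real.tendsto_pow_log_div_mul_add_atTop (1 / 2) (-1 / 2) 1 (by norm_num)).comp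
    (tendsto_atTop_add_const_right _ 1 (tendsto_natCast_atTop_atTop.const_mul_atTop two_pos))).congr
    fun N => ?_
  simp only [Function.comp_apply, pow_one]
  ring_nf

lemma tendsto_log_doubleFactorial_div_matchingNumber (d : (N : ℕ) → Fin N → ℕ)
    (hd : ∀ N, IsOneTwoDegrees p (d N)) :
    Tendsto (fun N : ℕ => Real.log ((∑ i, d N i).doubleFactorial / matchingNumber (∑ i, d N i)) / N)
      (evenSizes d) (𝓝 0) := by
  refine squeeze_zero' ?_ ?_ (tendsto_log_two_mul_add_one_div.mono_left inf_le_left)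
  · filter_upwards [eventually_evenSizes d] with N hN
    have hpos := matchingNumber_pos hN.2
    refine div_nonneg (Real.log_nonneg ((one_le_div (by positivity)).2 ?_)) N.cast_nonneg
    exact_mod_cast matchingNumber_le_doubleFactorial _
  · filter_upwards [eventually_evenSizes d] with N hN
    have hpos := matchingNumber_pos hN.2
    refine div_le_div_of_nonneg_right (Real.log_le_log (by positivity) ?_) N.cast_nonneg
    rw [div_le_iff₀ (by positivity)]
    exact_mod_cast (doubleFactorial_le_mul_matchingNumber hN.2).trans
      (Nat.mul_le_mul_right _ (Nat.succ_le_succ (sum_degree_le (hd N))))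

lemma tendsto_natFloor_mul_div (hp0 : 0 < p) :
    Tendsto (fun N : ℕ => (⌊p * (N : ℝ)⌋₊ : ℝ) / N) atTop (𝓝 p) :=
  (tendsto_nat_floor_mul_div_atTop hp0.le).comp tendsto_natCast_atTop_atTop

theorem tendsto_annealedPressure (hp0 : 0 < p) (hp1 : p < 1) (d : (N : ℕ) → Fin N → ℕ)
    (hd : ∀ N, IsOneTwoDegrees p (d N)) (hβ : 0 < β) (B : ℝ) :
    Tendsto (fun N => annealedPressure (d N) β B) (evenSizes d) (𝓝 (pressure p β B)) := by
  obtain ⟨hpos, havg⟩ := tendsto_log_circleAverage_circleWeight hp0 hp1 d hd hβ B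
  have hfloor := (tendsto_natFloor_mul_div hp0).mono_left (inf_le_left : evenSizes d ≤ atTop)
  have hlim := (tendsto_log_doubleFactorial_div_matchingNumber d hd).add
    ((((hfloor.const_sub 1).mul_const (Real.log (√(APlus β B) * lamPlus β B))).add
      (hfloor.mul_const (Real.log (lamPlus β B)))).add havg)
  have hl := lamPlus_pos β B
  have hA := Real.sqrt_pos.2 (APlus_pos hβ B)
  convert hlim.congr' ?_ using 2
  · rw [pressure, Real.log_mul hA.ne' hl.ne', Real.log_sqrt (APlus_pos hβ B).le]
    ring
  filter_upwards [eventually_evenSizes d, hpos] with N hN hpos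
  have hmatch := matchingNumber_pos hN.2
  have hN0 : (N : ℝ) ≠ 0 := by exact_mod_cast hN.1.ne'
  have hlog := congrArg Real.log (cmExpect_partitionFunction_eq_circleWeight hβ B (hd N))
  rw [Real.log_mul (by positivity) (by positivity), Real.log_mul (by positivity) hpos.ne',
    Real.log_mul (by positivity) (by positivity), Real.log_pow, Real.log_pow,
    Nat.cast_sub (natFloor_mul_lt hp0 hp1 hN.1).le] at hlog
  rw [annealedPressure, hlog]
  field_simp

end Limit

/-! ### Differentiability in the field -/

section Envelope

/-- A cluster point of the maximum points is a maximum point of the limiting function. -/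
lemma tendsto_of_isMaxOn {X Y : Type*} [TopologicalSpace X] [TopologicalSpace Y] {K : Set Y}
    (hK : IsCompact K) {F : X → Y → ℝ} {m : X → Y} {x₀ : X}
    (hF : ∀ y ∈ K, ContinuousAt (fun q : X × Y => F q.1 q.2) (x₀, y))
    (hm : ∀ᶠ x in 𝓝 x₀, m x ∈ K ∧ IsMaxOn (F x) K (m x))
    (hunique : ∀ y ∈ K, y ≠ m x₀ → F x₀ y < F x₀ (m x₀)) :
    Tendsto m (𝓝 x₀) (𝓝 (m x₀)) := by
  have hm₀ := hm.self_of_nhds.1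
  refine hK.tendsto_nhds_of_unique_mapClusterPt (hm.mono fun x hx => hx.1) fun y hy hcluster => ?_
  by_contra hne
  obtain ⟨c, hyc, hcm⟩ := exists_between (hunique y hy hne)
  have hnear := (hF y hy).eventually (gt_mem_nhds hyc)
  rw [nhds_prod_eq, eventually_prod_iff] at hnear
  obtain ⟨U, hU, V, hV, hUV⟩ := hnear
  have hbig : ∀ᶠ x in 𝓝 x₀, c < F x (m x₀) :=
    ((hF _ hm₀).comp (f := fun x => (x, m x₀)) (by fun_prop)).eventually (lt_mem_nhds hcm)
  obtain ⟨x, hVx, hUx, hcx, -, hmax⟩ :=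
    ((hcluster.frequently hV).and_eventually (hU.and (hbig.and hm))).exists
  exact (hcx.trans_le (hmax hm₀)).not_gt (hUV hUx hVx)

/-- The envelope theorem: the motion of the maximum point changes the maximum only to higher
order. -/
lemma hasDerivAt_isMaxOn {K : Set (ℝ × ℝ)} {e : ℝ × ℝ → ℝ} {α ρ : ℝ → ℝ} {m : ℝ → ℝ × ℝ}
    {α' ρ' x₀ : ℝ} (hα : HasDerivAt α α' x₀) (hρ : HasDerivAt ρ ρ' x₀) (hcont : ContinuousAt m x₀)
    (hm : ∀ᶠ x in 𝓝 x₀, m x ∈ K ∧ IsMaxOn (fun z => e z + z.1 * α x + z.2 * ρ x) K (m x)) :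
    HasDerivAt (fun x => e (m x) + (m x).1 * α x + (m x).2 * ρ x)
      ((m x₀).1 * α' + (m x₀).2 * ρ') x₀ := by
  have hfixed : HasDerivAt (fun x => e (m x₀) + (m x₀).1 * α x + (m x₀).2 * ρ x)
      ((m x₀).1 * α' + (m x₀).2 * ρ') x₀ :=
    ((hα.const_mul _).const_add _).add (hρ.const_mul _)
  have hbound : (fun x => ((m x).1 - (m x₀).1) * (α x - α x₀)
      + ((m x).2 - (m x₀).2) * (ρ x - ρ x₀)) =o[𝓝 x₀] fun x => x - x₀ := by
    have hm₁ : Tendsto (fun x => (m x).1 - (m x₀).1) (𝓝 x₀) (𝓝 0) :=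
      tendsto_sub_nhds_zero_iff.2 hcont.fst
    have hm₂ : Tendsto (fun x => (m x).2 - (m x₀).2) (𝓝 x₀) (𝓝 0) :=
      tendsto_sub_nhds_zero_iff.2 hcont.snd
    simpa only [one_mul] using
      (((Asymptotics.isLittleO_one_iff ℝ).2 hm₁).mul_isBigO hα.isBigO_sub).add
        (((Asymptotics.isLittleO_one_iff ℝ).2 hm₂).mul_isBigO hρ.isBigO_sub)
  have hmove : HasDerivAt (fun x => e (m x) + (m x).1 * α x + (m x).2 * ρ x
      - (e (m x₀) + (m x₀).1 * α x + (m x₀).2 * ρ x)) 0 x₀ := by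
    simp only [hasDerivAt_iff_isLittleO, sub_self, sub_zero, smul_zero]
    refine (Asymptotics.IsBigO.of_bound 1 ?_).trans_isLittleO hbound
    obtain ⟨hm₀, hmax₀⟩ := hm.self_of_nhds
    filter_upwards [hm] with x ⟨hmx, hmaxx⟩
    have hle := isMaxOn_iff.1 hmaxx _ hm₀
    have hle₀ := isMaxOn_iff.1 hmax₀ _ hmx
    rw [one_mul, Real.norm_of_nonneg (sub_nonneg.2 hle)]
    refine le_trans ?_ (le_abs_self _)
    linarith
  simpa using hfixed.fun_add hmove

end Envelope

section Derivative

variable {p β B : ℝ}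

lemma differentiable_lamPlus (β : ℝ) : Differentiable ℝ (lamPlus β) := fun B => by
  have hsqrt : DifferentiableAt ℝ (fun b => √(Real.sinh b ^ 2 + Real.exp (-4 * β))) B :=
    DifferentiableAt.sqrt (by fun_prop) (by positivity)
  exact ((Real.differentiable_cosh B).add hsqrt).const_mul _

lemma differentiable_lamMinus (β : ℝ) : Differentiable ℝ (lamMinus β) := fun B => by
  have hsqrt : DifferentiableAt ℝ (fun b => √(Real.sinh b ^ 2 + Real.exp (-4 * β))) B :=
    DifferentiableAt.sqrt (by fun_prop) (by positivity)
  exact ((Real.differentiable_cosh B).sub hsqrt).const_mul _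

lemma differentiable_APlus (β : ℝ) : Differentiable ℝ (APlus β) := fun B => by
  have hl := differentiable_lamPlus β B
  have hpos := lamPlus_pos β B
  exact DifferentiableAt.fun_div (by fun_prop) (by fun_prop) (by positivity)

lemma differentiable_AMinus (hβ : 0 < β) : Differentiable ℝ (AMinus β) := fun B => by
  have hl := differentiable_lamPlus β B
  have hl' := differentiable_lamMinus β B
  have hpos := lamMinus_pos hβ B
  exact DifferentiableAt.fun_div (by fun_prop) (by fun_prop) (by positivity)

lemma differentiable_rRatio (β : ℝ) : Differentiable ℝ (rRatio β) := fun B =>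
  (differentiable_lamMinus β B).fun_div (differentiable_lamPlus β B) (lamPlus_pos β B).ne'

lemma differentiable_aRatio_mul_rRatio_sq (hβ : 0 < β) :
    Differentiable ℝ fun b => aRatio β b * rRatio β b ^ 2 := fun B =>
  ((differentiable_AMinus hβ B).fun_div (differentiable_APlus β B) (APlus_pos hβ B).ne').fun_mul
    ((differentiable_rRatio β B).fun_pow 2)

lemma differentiableAt_log_lamPlus (β B : ℝ) :
    DifferentiableAt ℝ (fun b => Real.log (lamPlus β b)) B :=
  (differentiable_lamPlus β B).log (lamPlus_pos β B).ne'

lemma differentiableAt_log_APlus (hβ : 0 < β) (B : ℝ) :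
    DifferentiableAt ℝ (fun b => Real.log (APlus β b)) B :=
  (differentiable_APlus β B).log (APlus_pos hβ B).ne'

lemma differentiableAt_log_rRatio (hβ : 0 < β) (B : ℝ) :
    DifferentiableAt ℝ (fun b => Real.log (rRatio β b)) B :=
  (differentiable_rRatio β B).log (rRatio_pos hβ B).ne'

lemma differentiableAt_log_aRatio_mul_rRatio_sq (hβ : 0 < β) (hB : B ≠ 0) :
    DifferentiableAt ℝ (fun b => Real.log (aRatio β b * rRatio β b ^ 2)) B :=
  (differentiable_aRatio_mul_rRatio_sq hβ B).log
    (mul_pos (aRatio_pos hβ hB) (pow_pos (rRatio_pos hβ B) 2)).ne'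

lemma eventually_isMaxOn_H_maxPoint (hp0 : 0 < p) (hp1 : p < 1) (hβ : 0 < β) (hB : B ≠ 0) :
    ∀ᶠ b in 𝓝 B, maxPoint p β b ∈ rect p ∧ IsMaxOn (H p β b) (rect p) (maxPoint p β b) := by
  filter_upwards [isOpen_ne.mem_nhds hB] with b hb
  exact ⟨maxPoint_mem hp0 hp1 hβ b, isMaxOn_H_maxPoint hp0 hp1 hβ hb⟩

lemma continuousAt_maxPoint (hp0 : 0 < p) (hp1 : p < 1) (hβ : 0 < β) (hB : B ≠ 0) :
    ContinuousAt (maxPoint p β) B := by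
  refine tendsto_of_isMaxOn (isCompact_rect p) (fun z _ => ?_)
    (eventually_isMaxOn_H_maxPoint hp0 hp1 hβ hB) fun z hz => H_lt_H_maxPoint hp0 hp1 hβ hB hz
  simp only [H_eq]
  have hα := (differentiableAt_log_aRatio_mul_rRatio_sq hβ hB).continuousAt.comp (x := (B, z))
    continuousAt_fst
  have hρ := (differentiableAt_log_rRatio hβ B).continuousAt.comp (x := (B, z)) continuousAt_fst
  have he := ((continuous_rectEntropy p).comp continuous_snd).continuousAt (x := (B, z))
  exact (he.add (continuousAt_snd.fst.mul hα)).add (continuousAt_snd.snd.mul hρ)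

lemma hasDerivAt_H_maxPoint (hp0 : 0 < p) (hp1 : p < 1) (hβ : 0 < β) (hB : B ≠ 0) :
    HasDerivAt (fun b => H p β b (maxPoint p β b))
      ((maxPoint p β B).1 * deriv (fun b => Real.log (aRatio β b * rRatio β b ^ 2)) B
        + (maxPoint p β B).2 * deriv (fun b => Real.log (rRatio β b)) B) B := by
  have hmax := eventually_isMaxOn_H_maxPoint hp0 hp1 hβ hB
  simp only [H_eq, isMaxOn_iff] at hmax ⊢
  exact hasDerivAt_isMaxOn (differentiableAt_log_aRatio_mul_rRatio_sq hβ hB).hasDerivAt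
    (differentiableAt_log_rRatio hβ B).hasDerivAt (continuousAt_maxPoint hp0 hp1 hβ hB) hmax

lemma H_maxPoint_nonneg (hp0 : 0 < p) (hp1 : p < 1) (hβ : 0 < β) (B : ℝ) :
    0 ≤ H p β B (maxPoint p β B) := by
  rcases eq_or_ne B 0 with rfl | hB
  · rw [maxPoint_zero hp0 hp1 hβ, H_zero]
  · rw [← H_zero p β B]
    exact isMaxOn_iff.1 (isMaxOn_H_maxPoint hp0 hp1 hβ hB) _ (zero_mem_rect hp0 hp1)

lemma H_maxPoint_le (hp0 : 0 < p) (hp1 : p < 1) (hβ : 0 < β) (B : ℝ) :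
    H p β B (maxPoint p β B) ≤ (1 - p) / 2 * (aRatio β B * rRatio β B ^ 2) := by
  obtain ⟨x, y, hx, hy, hxy, hle⟩ := exists_H_maxPoint_le_circleRate hp0 hp1 hβ B
  rw [← vRatio_sq hβ]
  exact hle.trans (circleRate_le_mul_sq hp0 hp1 (vRatio_nonneg β B) (rRatio_pos hβ B).le
    (rRatio_le_one β B) hx.le hy hxy)

/-- In zero field the envelope theorem does not apply, as `log (a r²)` is singular there; instead
the maximum is squeezed between `0` and a multiple of `a r²`, which has a minimum at `0`. -/
lemma hasDerivAt_H_maxPoint_zero (hp0 : 0 < p) (hp1 : p < 1) (hβ : 0 < β) :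
    HasDerivAt (fun b => H p β b (maxPoint p β b)) 0 0 := by
  have hnonneg : ∀ b, 0 ≤ aRatio β b * rRatio β b ^ 2 := fun b =>
    mul_nonneg (aRatio_nonneg hβ b) (sq_nonneg _)
  have hzero : aRatio β 0 * rRatio β 0 ^ 2 = 0 := by
    rw [(aRatio_eq_zero_iff hβ 0).2 rfl, zero_mul]
  have hderiv : deriv (fun b => aRatio β b * rRatio β b ^ 2) 0 = 0 :=
    IsLocalMin.deriv_eq_zero (Eventually.of_forall fun b => hzero.le.trans (hnonneg b))
  have hsmall := (differentiable_aRatio_mul_rRatio_sq hβ 0).hasDerivAt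
  rw [hderiv, hasDerivAt_iff_isLittleO] at hsmall
  rw [hasDerivAt_iff_isLittleO]
  simp only [hzero, sub_zero, smul_zero] at hsmall ⊢
  refine (Asymptotics.IsBigO.of_bound ((1 - p) / 2) (.of_forall fun b => ?_)).trans_isLittleO hsmall
  rw [maxPoint_zero hp0 hp1 hβ, H_zero, sub_zero, Real.norm_of_nonneg (hnonneg b),
    Real.norm_of_nonneg (H_maxPoint_nonneg hp0 hp1 hβ b)]
  exact H_maxPoint_le hp0 hp1 hβ b

/-- The limiting magnetization. In zero field the third term is `0` because `maxPoint` is the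
origin, whatever the junk value of the derivative of `log (a r²)`. -/
noncomputable def magnetization (p β B : ℝ) : ℝ :=
  deriv (fun b => Real.log (lamPlus β b)) B
    + (1 - p) / 2 * deriv (fun b => Real.log (APlus β b)) B
    + (maxPoint p β B).1 * deriv (fun b => Real.log (aRatio β b * rRatio β b ^ 2)) B
    + (maxPoint p β B).2 * deriv (fun b => Real.log (rRatio β b)) B

theorem hasDerivAt_pressure (hp0 : 0 < p) (hp1 : p < 1) (hβ : 0 < β) (B : ℝ) :
    HasDerivAt (pressure p β) (magnetization p β B) B := by
  have hmax : HasDerivAt (fun b => H p β b (maxPoint p β b))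
      ((maxPoint p β B).1 * deriv (fun b => Real.log (aRatio β b * rRatio β b ^ 2)) B
        + (maxPoint p β B).2 * deriv (fun b => Real.log (rRatio β b)) B) B := by
    rcases eq_or_ne B 0 with rfl | hB
    · simpa [maxPoint_zero hp0 hp1 hβ] using hasDerivAt_H_maxPoint_zero hp0 hp1 hβ
    · exact hasDerivAt_H_maxPoint hp0 hp1 hβ hB
  have hsum := ((differentiableAt_log_lamPlus β B).hasDerivAt.add
    ((differentiableAt_log_APlus hβ B).hasDerivAt.const_mul ((1 - p) / 2))).add hmax
  rw [← add_assoc] at hsum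
  exact hsum

end Derivative

/-! ### Convexity in the field -/

section Convexity

variable {ι : Type*}

lemma sum_rpow_mul_rpow_le {s : Finset ι} {f g : ι → ℝ} (hf : ∀ i ∈ s, 0 ≤ f i)
    (hg : ∀ i ∈ s, 0 ≤ g i) {u v : ℝ} (hu : 0 < u) (hv : 0 < v) (huv : u + v = 1) :
    ∑ i ∈ s, f i ^ u * g i ^ v ≤ (∑ i ∈ s, f i) ^ u * (∑ i ∈ s, g i) ^ v := by
  have hholder := Real.inner_le_Lp_mul_Lq_of_nonneg s (Real.HolderConjugate.inv_inv hu hv huv)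
    (fun i hi => Real.rpow_nonneg (hf i hi) u) fun i hi => Real.rpow_nonneg (hg i hi) v
  rw [one_div, one_div, inv_inv, inv_inv,
    Finset.sum_congr rfl fun i hi => Real.rpow_rpow_inv (hf i hi) hu.ne',
    Finset.sum_congr rfl fun i hi => Real.rpow_rpow_inv (hg i hi) hv.ne'] at hholder
  exact hholder

variable [Fintype ι] [Nonempty ι] {a : ι → ℝ}

lemma sum_mul_exp_pos (ha : ∀ i, 0 < a i) (S : ι → ℝ) (b : ℝ) :
    0 < ∑ i, a i * Real.exp (b * S i) :=
  Finset.sum_pos (fun i _ => mul_pos (ha i) (Real.exp_pos _)) Finset.univ_nonempty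

lemma convexOn_log_sum_mul_exp (ha : ∀ i, 0 < a i) (S : ι → ℝ) :
    ConvexOn ℝ Set.univ fun b : ℝ => Real.log (∑ i, a i * Real.exp (b * S i)) := by
  refine convexOn_iff_forall_pos.2 ⟨convex_univ, fun x _ y _ u v hu hv huv => ?_⟩
  have hx := sum_mul_exp_pos ha S x
  have hy := sum_mul_exp_pos ha S y
  have hpow : ∀ i, a i * Real.exp ((u * x + v * y) * S i)
      = (a i * Real.exp (x * S i)) ^ u * (a i * Real.exp (y * S i)) ^ v := fun i => by
    rw [Real.mul_rpow (ha i).le (Real.exp_pos _).le, Real.mul_rpow (ha i).le (Real.exp_pos _).le,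
      mul_mul_mul_comm, ← Real.rpow_add (ha i), huv, Real.rpow_one, ← Real.exp_mul, ← Real.exp_mul,
      ← Real.exp_add]
    ring_nf
  simp only [smul_eq_mul]
  rw [← Real.log_rpow hx, ← Real.log_rpow hy,
    ← Real.log_mul (Real.rpow_pos_of_pos hx u).ne' (Real.rpow_pos_of_pos hy v).ne']
  refine Real.log_le_log (sum_mul_exp_pos ha S _) ?_
  simp only [hpow]
  exact sum_rpow_mul_rpow_le (fun i _ => (mul_pos (ha i) (Real.exp_pos _)).le)
    (fun i _ => (mul_pos (ha i) (Real.exp_pos _)).le) hu hv huv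

lemma hasDerivAt_log_sum_mul_exp (ha : ∀ i, 0 < a i) (S : ι → ℝ) (B : ℝ) :
    HasDerivAt (fun b : ℝ => Real.log (∑ i, a i * Real.exp (b * S i)))
      ((∑ i, a i * (Real.exp (B * S i) * S i)) / ∑ i, a i * Real.exp (B * S i)) B :=
  (HasDerivAt.fun_sum fun i _ => ((hasDerivAt_mul_const (S i)).exp).const_mul (a i)).log
    (sum_mul_exp_pos ha S B).ne'

end Convexity

section DerivativeLimit

variable {ι : Type*} {l : Filter ι} {f : ι → ℝ → ℝ} {f' : ι → ℝ} {g m : ℝ → ℝ} {x g' : ℝ}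

/-- The slopes at `x` of a convex function enclose its derivative, and they converge. -/
lemma tendsto_deriv_of_convexOn (hconv : ∀ᶠ n in l, ConvexOn ℝ Set.univ (f n))
    (hderiv : ∀ᶠ n in l, HasDerivAt (f n) (f' n) x)
    (hlim : ∀ y, Tendsto (fun n => f n y) l (𝓝 (g y))) (hg : HasDerivAt g g' x) :
    Tendsto f' l (𝓝 g') := by
  have hslope : ∀ y, Tendsto (fun n => slope (f n) x y) l (𝓝 (slope g x y)) := fun y => by
    simp only [slope_def_field]
    exact ((hlim y).sub (hlim x)).div_const _
  have hleft : Tendsto (slope g x) (𝓝[<] x) (𝓝 g') :=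
    (hasDerivAt_iff_tendsto_slope.1 hg).mono_left (nhdsLT_le_nhdsNE x)
  have hright : Tendsto (slope g x) (𝓝[>] x) (𝓝 g') :=
    (hasDerivAt_iff_tendsto_slope.1 hg).mono_left (nhdsGT_le_nhdsNE x)
  refine tendsto_order.2 ⟨fun c hc => ?_, fun c hc => ?_⟩
  · obtain ⟨y, hy, hyx⟩ := ((hleft.eventually (lt_mem_nhds hc)).and self_mem_nhdsWithin).exists
    filter_upwards [hconv, hderiv, (hslope y).eventually (lt_mem_nhds hy)] with n hn hn' hny
    rw [slope_comm] at hny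
    exact hny.trans_le (hn.slope_le_of_hasDerivAt (Set.mem_univ _) (Set.mem_univ _) hyx hn')
  · obtain ⟨y, hy, hxy⟩ := ((hright.eventually (gt_mem_nhds hc)).and self_mem_nhdsWithin).exists
    filter_upwards [hconv, hderiv, (hslope y).eventually (gt_mem_nhds hy)] with n hn hn' hny
    exact (hn.le_slope_of_hasDerivAt (Set.mem_univ _) (Set.mem_univ _) hxy hn').trans_lt hny

lemma continuous_of_hasDerivAt_of_convexOn (hconv : ConvexOn ℝ Set.univ g)
    (hderiv : ∀ x, HasDerivAt g (m x) x) : Continuous m := by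
  have hg : Continuous g := continuous_iff_continuousAt.2 fun x => (hderiv x).continuousAt
  refine continuous_iff_continuousAt.2 fun x => ?_
  have hshift : ∀ y, Tendsto (fun t => g (t + y)) (𝓝 x) (𝓝 (g (x + y))) := fun y =>
    (hg.comp (continuous_add_const y)).tendsto x
  refine tendsto_deriv_of_convexOn (f := fun t y => g (t + y)) (x := 0)
    (.of_forall fun t => ?_) (.of_forall fun t => ?_) hshift ?_
  · exact hconv.translate_right t
  · exact HasDerivAt.comp_const_add t 0 (by simpa using hderiv t)
  · exact HasDerivAt.comp_const_add x 0 (by simpa using hderiv x)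

lemma tendsto_deriv_zero_of_convexOn_of_even (hconv : ConvexOn ℝ Set.univ g)
    (heven : Function.Even g) (hderiv : ∀ x, HasDerivAt g (m x) x) : Tendsto m (𝓝 0) (𝓝 0) := by
  have hneg : deriv (fun y => g (-y)) 0 = -deriv g 0 := by rw [deriv_comp_neg, neg_zero]
  rw [funext heven, (hderiv 0).deriv] at hneg
  have hzero : m 0 = 0 := self_eq_neg.1 hneg
  have hcont := (continuous_of_hasDerivAt_of_convexOn hconv hderiv).tendsto 0
  rwa [hzero] at hcont

end DerivativeLimit

/-! ### The annealed magnetization -/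

section FiniteVolume

variable {N : ℕ} {d : Fin N → ℕ}

lemma cmExpect_boltzmannWeight (β B : ℝ) (σ : Fin N → ℤˣ) :
    cmExpect d (fun π => boltzmannWeight β B π σ)
      = cmExpect d (fun π => Real.exp (β * edgeSum π σ)) * Real.exp (B * totalSpin σ) := by
  simp only [cmExpect, boltzmannWeight, Real.exp_add]
  rw [← Finset.sum_mul, mul_div_right_comm]

lemma cmExpect_partitionFunction_eq_sum (β B : ℝ) :
    cmExpect d (partitionFunction β B)
      = ∑ σ : Fin N → ℤˣ,
        cmExpect d (fun π => Real.exp (β * edgeSum π σ)) * Real.exp (B * totalSpin σ) := by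
  simp only [← cmExpect_boltzmannWeight]
  simp only [cmExpect, partitionFunction]
  rw [← Finset.sum_div, Finset.sum_comm]

lemma cmExpect_exp_pos (heven : Even (∑ i, d i)) (β : ℝ) (σ : Fin N → ℤˣ) :
    0 < cmExpect d (fun π => Real.exp (β * edgeSum π σ)) := by
  have hcard : 0 < Fintype.card (Pairing d) :=
    (matchingNumber_pos (by simpa [HalfEdge] using heven)).trans_eq
      (card_matching (E := HalfEdge d)).symm
  have hne : Nonempty (Pairing d) := Fintype.card_pos_iff.1 hcard
  exact div_pos (Finset.sum_pos (fun _ _ => Real.exp_pos _) Finset.univ_nonempty)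
    (by exact_mod_cast hcard)

lemma convexOn_annealedPressure (heven : Even (∑ i, d i)) (β : ℝ) :
    ConvexOn ℝ Set.univ (annealedPressure d β) := by
  have hconv := (convexOn_log_sum_mul_exp (cmExpect_exp_pos heven β) totalSpin).smul
    (one_div_nonneg.2 N.cast_nonneg : 0 ≤ 1 / (N : ℝ))
  simp only [← cmExpect_partitionFunction_eq_sum, smul_eq_mul] at hconv
  exact hconv

lemma hasDerivAt_annealedPressure (heven : Even (∑ i, d i)) (β B : ℝ) :
    HasDerivAt (annealedPressure d β) (annealedMagnetization d β B) B := by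
  have hderiv := (hasDerivAt_log_sum_mul_exp (cmExpect_exp_pos heven β) totalSpin B).const_mul
    (1 / (N : ℝ))
  simp only [← cmExpect_partitionFunction_eq_sum] at hderiv
  refine hderiv.congr_deriv ?_
  simp only [annealedMagnetization, annealedMeasure, cmExpect_boltzmannWeight]
  rw [Finset.sum_div, Finset.mul_sum]
  exact Finset.sum_congr rfl fun σ _ => by ring

lemma even_annealedPressure (d : Fin N → ℕ) (β : ℝ) : Function.Even (annealedPressure d β) := by
  intro B
  have hflip : partitionFunction (d := d) β (-B) = partitionFunction β B := by
    funext π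
    refine Fintype.sum_equiv (Equiv.neg _) _ _ fun σ => ?_
    simp [boltzmannWeight, edgeSum, totalSpin, spin]
  rw [annealedPressure, annealedPressure, hflip]

end FiniteVolume

section Magnetization

variable {p β : ℝ}

lemma exists_natFloor_mul_succ_eq (hp0 : 0 < p) (hp1 : p < 1) (K : ℕ) :
    ∃ N ≥ K, ⌊p * ((N + 1 : ℕ) : ℝ)⌋₊ = ⌊p * (N : ℝ)⌋₊ := by
  by_contra! hne
  have hmono : StrictMono fun n : ℕ => ⌊p * ((K + n : ℕ) : ℝ)⌋₊ := strictMono_nat_of_lt_succ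
    fun n => lt_of_le_of_ne (by gcongr; lia) (hne (K + n) (Nat.le_add_right K n)).symm
  obtain ⟨n, hn⟩ := exists_nat_gt (p * K / (1 - p))
  have hle : (n : ℝ) ≤ p * ((K + n : ℕ) : ℝ) :=
    (Nat.cast_le.2 (hmono.le_apply (x := n))).trans (Nat.floor_le (by positivity))
  rw [div_lt_iff₀ (sub_pos.2 hp1)] at hn
  push_cast at hle
  linarith

lemma neBot_evenSizes (hp0 : 0 < p) (hp1 : p < 1) (d : (N : ℕ) → Fin N → ℕ)
    (hd : ∀ N, IsOneTwoDegrees p (d N)) : (evenSizes d).NeBot := by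
  refine frequently_mem_iff_neBot.1 (frequently_atTop.2 fun K => ?_)
  obtain ⟨N, hN, hfloor⟩ := exists_natFloor_mul_succ_eq hp0 hp1 (K + 1)
  have hlt := natFloor_mul_lt hp0 hp1 (by lia : 0 < N)
  rcases Nat.even_or_odd (N - ⌊p * (N : ℝ)⌋₊) with heven | hodd
  · exact ⟨N, by lia, by
      change Even _
      rw [sum_degree (hd N)]
      exact heven.add (even_two_mul _)⟩
  · exact ⟨N + 1, by lia, by
      change Even _
      rw [sum_degree (hd (N + 1)), hfloor, Nat.sub_add_comm hlt.le]
      exact hodd.add_one.add (even_two_mul _)⟩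

lemma convexOn_pressure (hp0 : 0 < p) (hp1 : p < 1) (d : (N : ℕ) → Fin N → ℕ)
    (hd : ∀ N, IsOneTwoDegrees p (d N)) (hβ : 0 < β) : ConvexOn ℝ Set.univ (pressure p β) := by
  have := neBot_evenSizes hp0 hp1 d hd
  have hlim := tendsto_annealedPressure hp0 hp1 d hd hβ
  refine ⟨convex_univ, fun x _ y _ u v hu hv huv => ?_⟩
  refine le_of_tendsto_of_tendsto (hlim _) (((hlim x).const_smul u).add ((hlim y).const_smul v)) ?_
  filter_upwards [eventually_evenSizes d] with N hN
  exact (convexOn_annealedPressure hN.2 β).2 (Set.mem_univ _) (Set.mem_univ _) hu hv huv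

lemma even_pressure (hp0 : 0 < p) (hp1 : p < 1) (d : (N : ℕ) → Fin N → ℕ)
    (hd : ∀ N, IsOneTwoDegrees p (d N)) (hβ : 0 < β) : Function.Even (pressure p β) := fun B => by
  have := neBot_evenSizes hp0 hp1 d hd
  have hlim := tendsto_annealedPressure hp0 hp1 d hd hβ
  exact tendsto_nhds_unique (hlim (-B))
    ((hlim B).congr fun N => (even_annealedPressure (d N) β B).symm)

theorem tendsto_annealedMagnetization (hp0 : 0 < p) (hp1 : p < 1) (d : (N : ℕ) → Fin N → ℕ)
    (hd : ∀ N, IsOneTwoDegrees p (d N)) (hβ : 0 < β) (B : ℝ) :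
    Tendsto (fun N => annealedMagnetization (d N) β B) (evenSizes d)
      (𝓝 (magnetization p β B)) :=
  tendsto_deriv_of_convexOn
    ((eventually_evenSizes d).mono fun _ hN => convexOn_annealedPressure hN.2 β)
    ((eventually_evenSizes d).mono fun _ hN => hasDerivAt_annealedPressure hN.2 β B)
    (tendsto_annealedPressure hp0 hp1 d hd hβ) (hasDerivAt_pressure hp0 hp1 hβ B)

theorem tendsto_magnetization_zero (hp0 : 0 < p) (hp1 : p < 1) (d : (N : ℕ) → Fin N → ℕ)
    (hd : ∀ N, IsOneTwoDegrees p (d N)) (hβ : 0 < β) :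
    Tendsto (magnetization p β) (𝓝 0) (𝓝 0) :=
  tendsto_deriv_zero_of_convexOn_of_even (convexOn_pressure hp0 hp1 d hd hβ)
    (even_pressure hp0 hp1 d hd hβ) (hasDerivAt_pressure hp0 hp1 hβ)

lemma criticalInverseTemperature_eq_top {M : ℝ → ℝ → ℝ}
    (hM : ∀ β, 0 < β → Tendsto (M β) (𝓝[>] 0) (𝓝 0)) : criticalInverseTemperature M = ⊤ := by
  rw [criticalInverseTemperature, sInf_eq_top]
  rintro _ ⟨β, ⟨hβ, m, hm, hlim⟩, rfl⟩
  exact absurd (tendsto_nhds_unique hlim (hM β hβ)) hm.ne'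

end Magnetization

end AnnealedIsing

theorem mainTheorem5 (p : ℝ) (hp0 : 0 < p) (hp1 : p < 1)
    (d : (N : ℕ) → Fin N → ℕ) (hd : ∀ N, AnnealedIsing.IsOneTwoDegrees p (d N)) :
    ∃ s t ψ M : ℝ → ℝ → ℝ,
      (∀ β B : ℝ, 0 < β →
        -- `(s, t)` is the unique maximum point of `H` on the rectangle
        ((s β B, t β B) ∈ AnnealedIsing.rect p ∧
          ∀ z ∈ AnnealedIsing.rect p, z ≠ (s β B, t β B) →
            AnnealedIsing.HExt p β B z < AnnealedIsing.HExt p β B (s β B, t β B)) ∧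
        -- the annealed pressure
        Tendsto (fun N => AnnealedIsing.annealedPressure (d N) β B)
          (AnnealedIsing.evenSizes d) (𝓝 (ψ β B)) ∧
        ψ β B = Real.log (AnnealedIsing.lamPlus β B)
          + (1 - p) / 2 * Real.log (AnnealedIsing.APlus β B)
          + AnnealedIsing.H p β B (s β B, t β B) ∧
        -- the annealed magnetization
        Tendsto (fun N => AnnealedIsing.annealedMagnetization (d N) β B)
          (AnnealedIsing.evenSizes d) (𝓝 (M β B)) ∧
        HasDerivAt (ψ β) (M β B) B ∧
        DifferentiableAt ℝ (fun b => Real.log (AnnealedIsing.lamPlus β b)) B ∧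
        DifferentiableAt ℝ (fun b => Real.log (AnnealedIsing.APlus β b)) B ∧
        DifferentiableAt ℝ (fun b => Real.log (AnnealedIsing.rRatio β b)) B ∧
        M β B = deriv (fun b => Real.log (AnnealedIsing.lamPlus β b)) B
          + (1 - p) / 2 * deriv (fun b => Real.log (AnnealedIsing.APlus β b)) B
          + s β B * deriv (fun b =>
              Real.log (AnnealedIsing.aRatio β b * AnnealedIsing.rRatio β b ^ 2)) B
          + t β B * deriv (fun b => Real.log (AnnealedIsing.rRatio β b)) B ∧
        -- nonzero field
        (B ≠ 0 →
          0 < AnnealedIsing.aRatio β B ∧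
          StrictConcaveOn ℝ (AnnealedIsing.rect p) (AnnealedIsing.H p β B) ∧
          (s β B, t β B) ∈ interior (AnnealedIsing.rect p) ∧
          DifferentiableAt ℝ (fun b =>
            Real.log (AnnealedIsing.aRatio β b * AnnealedIsing.rRatio β b ^ 2)) B) ∧
        -- zero field
        (B = 0 → AnnealedIsing.aRatio β B = 0 ∧ s β B = 0 ∧ t β B = 0)) ∧
      -- absence of a phase transition
      (∀ β : ℝ, 0 < β → Tendsto (M β) (𝓝[>] 0) (𝓝 0)) ∧
      AnnealedIsing.criticalInverseTemperature M = ⊤ := by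
  have hlim : ∀ β : ℝ, 0 < β → Tendsto (AnnealedIsing.magnetization p β) (𝓝[>] 0) (𝓝 0) :=
    fun β hβ => (AnnealedIsing.tendsto_magnetization_zero hp0 hp1 d hd hβ).mono_left
      nhdsWithin_le_nhds
  refine ⟨fun β B => (AnnealedIsing.maxPoint p β B).1, fun β B => (AnnealedIsing.maxPoint p β B).2,
    AnnealedIsing.pressure p, AnnealedIsing.magnetization p, fun β B hβ => ?_, hlim,
    AnnealedIsing.criticalInverseTemperature_eq_top hlim⟩
  refine ⟨AnnealedIsing.maxPoint_spec hp0 hp1 hβ B,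
    AnnealedIsing.tendsto_annealedPressure hp0 hp1 d hd hβ B, rfl,
    AnnealedIsing.tendsto_annealedMagnetization hp0 hp1 d hd hβ B,
    AnnealedIsing.hasDerivAt_pressure hp0 hp1 hβ B, AnnealedIsing.differentiableAt_log_lamPlus β B,
    AnnealedIsing.differentiableAt_log_APlus hβ B, AnnealedIsing.differentiableAt_log_rRatio hβ B,
    rfl, fun hB => ?_, ?_⟩
  · exact ⟨AnnealedIsing.aRatio_pos hβ hB, AnnealedIsing.strictConcaveOn_H hp1 β B,
      AnnealedIsing.maxPoint_mem_interior hp0 hp1 hβ hB,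
      AnnealedIsing.differentiableAt_log_aRatio_mul_rRatio_sq hβ hB⟩
  · rintro rfl
    have hzero := AnnealedIsing.maxPoint_zero hp0 hp1 hβ
    exact ⟨(AnnealedIsing.aRatio_eq_zero_iff hβ 0).2 rfl, congrArg Prod.fst hzero,
      congrArg Prod.snd hzero⟩
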